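/- Let $C$ be a commutative $\mathbb{C}$-algebra and let $A$ and $B$ be Azumaya algebras over $C$. Algebras are associative and unital, not necessarily commutative. For a commutative ring $K$, a $K$-algebra $E$ and a $K$-algebra $R$, let $R\ast_K E$ be the coproduct of $K$-algebras (the pushout of $R\leftarrow K\to E$ in rings), and let the root algebra $\sqrt[E]{R}=(R\ast_K E)^E$ be the centralizer of the image of $E$ in $R\ast_K E$ (the base $K$ is understood); it is a $K$-algebra, functorial in $R$. For a $\mathbb{C}$-algebra $S$ put $\sqrt[n]{S}=\sqrt[M_n(\mathbb{C})]{S}$, formed over $\mathbb{C}$. 1. There are isomorphisms of $C$-algebras $$\sqrt[A]{\sqrt[B]{R}}\;\simeq\;\sqrt[A\otimes_C B]{R}\;\simeq\;\sqrt[B]{\sqrt[A]{R}},$$ natural in the $C$-algebra $R$. They are the canonical ones: the first is the restriction of the map $\sqrt[B]{R}\ast_C A\to R\ast_C(A\otimes_C B)$ induced by $R\ast_C B\to R\ast_C(A\otimes_C B)$, $b\mapsto 1\otimes b$, and by $a\mapsto a\otimes 1$; the map from $\sqrt[B]{\sqrt[A]{R}}$ is obtained in the same way with the roles of $A$ and $B$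 exchanged. 2. For every commutative $C$-algebra $D$ there are isomorphisms of $D$-algebras $$\sqrt[A]{R}\otimes_C D\;\simeq\;\sqrt[A\otimes_C D]{R\otimes_C D}$$ (the right-hand side formed over $D$), natural in the $C$-algebra $R$. They are the canonical ones, induced by the map $R\ast_C A\to (R\otimes_C D)\ast_D(A\otimes_C D)$. 3. Suppose that $A$ is of constant degree $n$, i.e. of constant rank $n^2$ as a $C$-module. Then $\sqrt[A]{S\otimes_{\mathbb{C}} C}$ is, étale locally on $C$, isomorphic to $\sqrt[n]{S}\otimes_{\mathbb{C}} C$: there is a faithfully flat étale $C$-algebra $D$ such that, for every $\mathbb{C}$-algebra $S$, there is an isomorphism of $D$-algebras $$\sqrt[A]{S\otimes_{\mathbb{C}} C}\otimes_C D\;\simeq\;(\sqrt[n]{S}\otimes_{\mathbb{C}} C)\otimes_C D.$$ 4. Every $C$-algebra morphism $f\colon A\to B$ induces $C$-algebra morphisms $\psi_R\colon\sqrt[B]{R}\to\sqrt[A]{R}$, natural in the $C$-algebra $R$. Here, writing $\eta_A\colon R\to A\otimes_C\sqrt[A]{R}$ for the universal map, which corresponds to $R\to R\ast_C A$ under the multiplication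 map $A\otimes_C\sqrt[A]{R}\to R\ast_C A$ (and similarly $\eta_B$), $\psi_R$ is the unique $C$-algebra morphism with $(\mathrm{id}_B\otimes\psi_R)\circ\eta_B=(f\otimes\mathrm{id})\circ\eta_A$. -/

import Mathlib

open scoped TensorProduct

universe u v w x y z

noncomputable section

/-- The relations imposed on the tensor algebra of `R × A` to obtain the coproduct: the two
inclusions of `R` and `A` become unital and multiplicative. -/
inductive AlgCoprodRel (C : Type u) [CommRing C] (R : Type v) [Ring R] [Algebra C R]
    (A : Type w) [Ring A] [Algebra C A] :
    TensorAlgebra C (R × A) → TensorAlgebra C (R × A) → Prop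
  | inl_one : AlgCoprodRel C R A (TensorAlgebra.ι C ((1 : R), (0 : A))) 1
  | inr_one : AlgCoprodRel C R A (TensorAlgebra.ι C ((0 : R), (1 : A))) 1
  | inl_mul (r s : R) : AlgCoprodRel C R A (TensorAlgebra.ι C (r * s, (0 : A)))
      (TensorAlgebra.ι C (r, (0 : A)) * TensorAlgebra.ι C (s, (0 : A)))
  | inr_mul (a b : A) : AlgCoprodRel C R A (TensorAlgebra.ι C ((0 : R), a * b))
      (TensorAlgebra.ι C ((0 : R), a) * TensorAlgebra.ι C ((0 : R), b))

/-- The coproduct `R ∗_C A` of two (not necessarily commutative) `C`-algebras, i.e. the pushout of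
`R ← C → A` in the category of rings. -/
def AlgCoprod (C : Type u) [CommRing C] (R : Type v) [Ring R] [Algebra C R]
    (A : Type w) [Ring A] [Algebra C A] : Type (max u v w) :=
  RingQuot (AlgCoprodRel C R A)

namespace AlgCoprod

section

variable (C : Type u) [CommRing C] (R : Type v) [Ring R] [Algebra C R]
  (A : Type w) [Ring A] [Algebra C A]

instance : Ring (AlgCoprod C R A) := inferInstanceAs (Ring (RingQuot (AlgCoprodRel C R A)))

instance : Algebra C (AlgCoprod C R A) :=
  inferInstanceAs (Algebra C (RingQuot (AlgCoprodRel C R A)))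

/-- The quotient map from the tensor algebra. -/
def mk : TensorAlgebra C (R × A) →ₐ[C] AlgCoprod C R A :=
  RingQuot.mkAlgHom C (AlgCoprodRel C R A)

theorem mk_rel {p q : TensorAlgebra C (R × A)} (h : AlgCoprodRel C R A p q) :
    mk C R A p = mk C R A q :=
  RingQuot.mkAlgHom_rel C h

/-- The canonical map `R → R ∗_C A`. -/
def inl : R →ₐ[C] AlgCoprod C R A :=
  AlgHom.ofLinearMap
    ((mk C R A).toLinearMap ∘ₗ TensorAlgebra.ι C ∘ₗ LinearMap.inl C R A)
    ((mk_rel C R A AlgCoprodRel.inl_one).trans (map_one _))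
    (fun r s => (mk_rel C R A (AlgCoprodRel.inl_mul r s)).trans (map_mul _ _ _))

/-- The canonical map `A → R ∗_C A`. -/
def inr : A →ₐ[C] AlgCoprod C R A :=
  AlgHom.ofLinearMap
    ((mk C R A).toLinearMap ∘ₗ TensorAlgebra.ι C ∘ₗ LinearMap.inr C R A)
    ((mk_rel C R A AlgCoprodRel.inr_one).trans (map_one _))
    (fun a b => (mk_rel C R A (AlgCoprodRel.inr_mul a b)).trans (map_mul _ _ _))

variable {C R A}

/-- The map `R ∗_C A → T` with prescribed restrictions to `R` and to `A`. -/
def lift {T : Type x} [Ring T] [Algebra C T] (f : R →ₐ[C] T) (g : A →ₐ[C] T) :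
    AlgCoprod C R A →ₐ[C] T :=
  RingQuot.liftAlgHom C
    ⟨TensorAlgebra.lift C (f.toLinearMap.coprod g.toLinearMap), by
      intro p q h
      cases h <;> simp⟩

@[simp]
theorem lift_inl {T : Type x} [Ring T] [Algebra C T] (f : R →ₐ[C] T) (g : A →ₐ[C] T) (r : R) :
    lift f g (inl C R A r) = f r := by
  change RingQuot.liftAlgHom C _ (RingQuot.mkAlgHom C _ (TensorAlgebra.ι C (r, (0 : A)))) = f r
  rw [RingQuot.liftAlgHom_mkAlgHom_apply]
  simp

@[simp]
theorem lift_inr {T : Type x} [Ring T] [Algebra C T] (f : R →ₐ[C] T) (g : A →ₐ[C] T) (a : A) :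
    lift f g (inr C R A a) = g a := by
  change RingQuot.liftAlgHom C _ (RingQuot.mkAlgHom C _ (TensorAlgebra.ι C ((0 : R), a))) = g a
  rw [RingQuot.liftAlgHom_mkAlgHom_apply]
  simp

theorem hom_ext {T : Type x} [Ring T] [Algebra C T] {f g : AlgCoprod C R A →ₐ[C] T}
    (hl : ∀ r, f (inl C R A r) = g (inl C R A r))
    (hr : ∀ a, f (inr C R A a) = g (inr C R A a)) : f = g := by
  have key : f.comp (mk C R A) = g.comp (mk C R A) := by
    apply TensorAlgebra.hom_ext
    apply LinearMap.prod_ext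
    · ext r
      exact hl r
    · ext a
      exact hr a
  ext t
  obtain ⟨p, rfl⟩ := RingQuot.mkAlgHom_surjective C (AlgCoprodRel C R A) t
  exact AlgHom.congr_fun key p

/-- Functoriality of the coproduct in both arguments. -/
def map {R' : Type x} [Ring R'] [Algebra C R'] {A' : Type y} [Ring A'] [Algebra C A']
    (f : R →ₐ[C] R') (g : A →ₐ[C] A') : AlgCoprod C R A →ₐ[C] AlgCoprod C R' A' :=
  lift ((inl C R' A').comp f) ((inr C R' A').comp g)

/-- For a commutative `C`-algebra `D`, the canonical map
`R ∗_C A → (D ⊗_C R) ∗_D (D ⊗_C A)`, given on `R` by `r ↦ 1 ⊗ r` and on `A` by `a ↦ 1 ⊗ a`. -/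
def baseChange (D : Type x) [CommRing D] [Algebra C D] :
    AlgCoprod C R A →+* AlgCoprod D (D ⊗[C] R) (D ⊗[C] A) :=
  letI : Algebra C (AlgCoprod D (D ⊗[C] R) (D ⊗[C] A)) :=
    Algebra.compHom _ (algebraMap C D)
  haveI : IsScalarTower C D (AlgCoprod D (D ⊗[C] R) (D ⊗[C] A)) :=
    IsScalarTower.of_algebraMap_eq fun _ => rfl
  (lift
    (((inl D (D ⊗[C] R) (D ⊗[C] A)).restrictScalars C).comp
      (Algebra.TensorProduct.includeRight : R →ₐ[C] D ⊗[C] R))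
    (((inr D (D ⊗[C] R) (D ⊗[C] A)).restrictScalars C).comp
      (Algebra.TensorProduct.includeRight : A →ₐ[C] D ⊗[C] A))).toRingHom

end

end AlgCoprod

/-- The centralizer `(R ∗_C A)^A` of `A` in `R ∗_C A`, as a `C`-subalgebra. -/
def rootSubalgebra (C : Type u) [CommRing C] (A : Type w) [Ring A] [Algebra C A]
    (R : Type v) [Ring R] [Algebra C R] : Subalgebra C (AlgCoprod C R A) :=
  Subalgebra.centralizer C (Set.range (AlgCoprod.inr C R A))

/-- The `A`-th root algebra of the `C`-algebra `R`. -/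
abbrev RootAlgebra (C : Type u) [CommRing C] (A : Type w) [Ring A] [Algebra C A]
    (R : Type v) [Ring R] [Algebra C R] : Type (max u v w) :=
  rootSubalgebra C A R

/-- The `n`-th root algebra of a `ℂ`-algebra `S`: the centralizer of `M_n(ℂ)` in `S ∗ M_n(ℂ)`. -/
abbrev NthRootAlgebra (n : ℕ) (S : Type v) [Ring S] [Algebra ℂ S] : Type v :=
  RootAlgebra ℂ (Matrix (Fin n) (Fin n) ℂ) S

namespace RootAlgebra

section

variable {C : Type u} [CommRing C] {A : Type w} [Ring A] [Algebra C A]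
  {R : Type v} [Ring R] [Algebra C R]

/-- Functoriality of the root algebra in `R`: the restriction of `g ∗ id_A` to centralizers. -/
def map (A : Type w) [Ring A] [Algebra C A] {R' : Type x} [Ring R'] [Algebra C R']
    (g : R →ₐ[C] R') : RootAlgebra C A R →ₐ[C] RootAlgebra C A R' :=
  ((AlgCoprod.map g (AlgHom.id C A)).comp (rootSubalgebra C A R).val).codRestrict
    (rootSubalgebra C A R') (by
      rintro ⟨t, ht⟩
      refine (Subalgebra.mem_centralizer_iff C).2 ?_
      rintro _ ⟨a, rfl⟩
      have h := congrArg (AlgCoprod.map g (AlgHom.id C A))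
        ((Subalgebra.mem_centralizer_iff C).1 ht _ ⟨a, rfl⟩)
      simpa [AlgCoprod.map] using h)

/-- Given algebra maps `i : A → E` and `j : B → E`, the canonical map from
`RootAlgebra C B R ∗_C A` to `R ∗_C E`: on `RootAlgebra C B R ⊆ R ∗_C B` it is the restriction of
`id_R ∗ j`, and on `A` it is `i` followed by the inclusion of `E`. -/
def iterateMap {B : Type x} [Ring B] [Algebra C B] {E : Type y} [Ring E] [Algebra C E]
    (R : Type v) [Ring R] [Algebra C R] (i : A →ₐ[C] E) (j : B →ₐ[C] E) :
    AlgCoprod C (RootAlgebra C B R) A →ₐ[C] AlgCoprod C R E :=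
  AlgCoprod.lift
    ((AlgCoprod.map (AlgHom.id C R) j).comp (rootSubalgebra C B R).val)
    ((AlgCoprod.inr C R E).comp i)

variable (C A R) in
/-- The multiplication map `A ⊗_C (R ∗_C A)^A → R ∗_C A`, `a ⊗ t ↦ a t`. It is an isomorphism when
`A` is Azumaya over `C`. -/
def mulMap : A ⊗[C] RootAlgebra C A R →ₐ[C] AlgCoprod C R A :=
  Algebra.TensorProduct.lift (AlgCoprod.inr C R A) (rootSubalgebra C A R).val
    (fun a t => (Subalgebra.mem_centralizer_iff C).1 t.2 _ ⟨a, rfl⟩)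

/-- `η : R → A ⊗_C RootAlgebra C A R` is the universal map (the unit of the adjunction between
the root algebra and `A ⊗_C -`): it corresponds to the canonical map `R → R ∗_C A` under the
multiplication map `A ⊗_C RootAlgebra C A R → R ∗_C A`. -/
def IsUniversalMap (η : R →ₐ[C] A ⊗[C] RootAlgebra C A R) : Prop :=
  ∀ r : R, mulMap C A R (η r) = AlgCoprod.inl C R A r

/-- `ψ : RootAlgebra C B R → RootAlgebra C A R` is induced by the algebra map `f : A → B`: it is the
map that corresponds, under the universal property of `RootAlgebra C B R`, to the composite
`R → A ⊗_C RootAlgebra C A R → B ⊗_C RootAlgebra C A R` of the universal map for `A` with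
`f ⊗ id`. -/
def IsInducedBy {B : Type x} [Ring B] [Algebra C B] (f : A →ₐ[C] B)
    (ψ : RootAlgebra C B R →ₐ[C] RootAlgebra C A R) : Prop :=
  ∃ (ηA : R →ₐ[C] A ⊗[C] RootAlgebra C A R) (ηB : R →ₐ[C] B ⊗[C] RootAlgebra C B R),
    IsUniversalMap ηA ∧ IsUniversalMap ηB ∧
      (Algebra.TensorProduct.map (AlgHom.id C B) ψ).comp ηB =
        (Algebra.TensorProduct.map f (AlgHom.id C (RootAlgebra C A R))).comp ηA

end

end RootAlgebra

end

/-! An Azumaya algebra behaves like a matrix algebra towards every algebra `T` under it: `A ⊗ T^A →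
T` is bijective. All of this comes from finitely many elements of `A ⊗ A`, an `AzumayaFrame`. Since
`A ⊗ A` acts on `A` by `x ↦ p x q` as the full endomorphism ring, there are tensors acting as `x ↦ f
i x • 1`, with `f i` the forms of a dual basis. The identities between these tensors make sense in
every `T` under `A`, so there they project `T` onto the centralizer and recover `t` from its
projections (`centralizerMul_bijective`). Applied to `A ⊗ S`, the same tensors show that the
centralizer of `A` is `1 ⊗ S` (`eq_one_tmul_component`).

Consequently the root algebra is left adjoint to `A ⊗ -` (`desc`, `hom_ext_of_map_comp_unit`), and
the map induced by `A → B` is the one this adjunction dictates. Iterated roots and base change are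
handled on coproducts: `B ⊗ (RootAlgebra C B R ∗ A)` is `R ∗ (A ⊗ B)`, and `D ⊗ -` commutes with
`∗`. Passing to centralizers gives the statements about roots, and no flatness of `D` is needed.

For the étale local statement it suffices to split `A` by a faithfully flat étale `D`; base change
then replaces `A` by a matrix algebra. Over an algebraic closure `K` of a residue field, `A` becomes
`M_n(K)`, and in characteristic zero some `a` in `A` has image with separable characteristic
polynomial. A monic polynomial over `C` killing `a` factors over `K` as `(X - l) ^ m * h` with
coprime factors, where `l` is an eigenvalue. This factorization lifts to an étale algebra, and gives
there an idempotent `ε` of `D ⊗ A` whose image in `M_n(K)` is a projection onto a line. The left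
ideal generated by `ε` is projective with fibre of rank `n`, so left multiplication on it gives `A →
M_n` after localization. This splits `A` near the given prime, and quasi-compactness of the spectrum
finishes. -/

noncomputable section

/-! ### Frames of an Azumaya algebra and centralizers. -/

section Frame

variable {C : Type*} [CommRing C] {A : Type*} [Ring A] [Algebra C A]
  {T : Type*} [Ring T] [Algebra C T]

/-- The action of `A ⊗ A` on an algebra `T` under `A`, with `p ⊗ q` acting as `t ↦ p t q`. -/
def sandwich (φ : A →ₐ[C] T) : A ⊗[C] A →ₗ[C] T →ₗ[C] T :=
  TensorProduct.lift
    (LinearMap.mk₂ C (fun p q => LinearMap.mulLeft C (φ p) ∘ₗ LinearMap.mulRight C (φ q))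
      (fun p p' q => by ext t; simp [add_mul])
      (fun c p q => by ext t; simp)
      (fun p q q' => by ext t; simp [mul_add])
      (fun c p q => by ext t; simp))

@[simp]
theorem sandwich_tmul (φ : A →ₐ[C] T) (p q : A) (t : T) :
    sandwich φ (p ⊗ₜ q) t = φ p * t * φ q := by
  simp [sandwich, mul_assoc]

theorem sandwich_tmul_one_mul (φ : A →ₐ[C] T) (x : A) (τ : A ⊗[C] A) (t : T) :
    sandwich φ ((x ⊗ₜ 1) * τ) t = φ x * sandwich φ τ t := by
  induction τ with
  | zero => simp
  | tmul p q => simp [mul_assoc]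
  | add a b ha hb => simp [mul_add, ha, hb]

theorem sandwich_mul_one_tmul (φ : A →ₐ[C] T) (x : A) (τ : A ⊗[C] A) (t : T) :
    sandwich φ (τ * (1 ⊗ₜ x)) t = sandwich φ τ t * φ x := by
  induction τ with
  | zero => simp
  | tmul p q => simp [mul_assoc]
  | add a b ha hb => simp [add_mul, ha, hb]

theorem sandwich_comp {T' : Type*} [Ring T'] [Algebra C T'] (φ : A →ₐ[C] T) (g : T →ₐ[C] T')
    (τ : A ⊗[C] A) (t : T) :
    sandwich (g.comp φ) τ (g t) = g (sandwich φ τ t) := by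
  induction τ with
  | zero => simp
  | tmul p q => simp
  | add a b ha hb => simp [ha, hb]

theorem sandwich_mul_of_commute (φ : A →ₐ[C] T) {s : T} (hs : ∀ a, φ a * s = s * φ a)
    (τ : A ⊗[C] A) (t : T) : sandwich φ τ (t * s) = sandwich φ τ t * s := by
  induction τ with
  | zero => simp
  | tmul p q => simp [mul_assoc, hs]
  | add a b ha hb => simp [add_mul, ha, hb]

variable (C A) in
/-- Elements of `A`, linear forms on `A` and elements of `A ⊗ A` which realise the endomorphisms
`x ↦ f i x • 1`, such that the forms are dual to the elements, together with a linear form with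
value `1` at `1`. -/
structure AzumayaFrame where
  rank : ℕ
  vec : Fin rank → A
  form : Fin rank → A →ₗ[C] C
  tensor : Fin rank → A ⊗[C] A
  unitForm : A →ₗ[C] C
  sum_vec_mul_tensor : ∑ i, (vec i ⊗ₜ 1) * tensor i = 1
  sandwich_tensor : ∀ i x, sandwich (AlgHom.id C A) (tensor i) x = algebraMap C A (form i x)
  tmul_one_mul_tensor : ∀ i x, (x ⊗ₜ 1) * tensor i = tensor i * (1 ⊗ₜ x)
  unitForm_one : unitForm 1 = 1

-- Every value `h x` is the value at `1` of `h ∘ (· * x)`, so a dual basis shows `A = I A` for the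
-- ideal `I` generated by the values at `1`. Nakayama and faithfulness force `1 ∈ I`, and those
-- values already form an ideal.
variable (C A) in
theorem exists_linearMap_apply_one_eq_one [Module.Projective C A] [FaithfulSMul C A]
    [Module.Finite C A] : ∃ f : A →ₗ[C] C, f 1 = 1 := by
  obtain ⟨n, g, f, -, -, hfg⟩ := Module.Finite.exists_comp_eq_id_of_projective C A
  let I : Ideal C := Ideal.span {c | ∃ h : A →ₗ[C] C, h 1 = c}
  have hI : ∀ (h : A →ₗ[C] C) (x : A), h x ∈ I := fun h x =>
    Ideal.subset_span ⟨h ∘ₗ LinearMap.mulRight C x, by simp⟩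
  have key : (⊤ : Submodule C A) ≤ I • ⊤ := by
    intro x _
    have : x = ∑ i, (f x i) • g (Pi.single i 1) := by
      conv_lhs => rw [← LinearMap.id_apply (R := C) x, ← hfg, LinearMap.comp_apply]
      conv_lhs => rw [← LinearMap.sum_single_apply (fun _ => C) (f x)]
      rw [map_sum]
      refine Finset.sum_congr rfl fun i _ => ?_
      rw [← map_smul]
      congr 1
      ext j
      simp [Pi.single_apply]
    rw [this]
    exact Submodule.sum_mem _ fun i _ =>
      Submodule.smul_mem_smul (hI (LinearMap.proj i ∘ₗ f) x) trivial
  obtain ⟨r, hr, hr0⟩ := Submodule.exists_sub_one_mem_and_smul_eq_zero_of_fg_of_le_smul I ⊤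
    Module.Finite.fg_top key
  have hr0' : r = 0 := by
    apply FaithfulSMul.algebraMap_injective C A
    rw [map_zero, Algebra.algebraMap_eq_smul_one]
    exact hr0 _ trivial
  have h1 : (1 : C) ∈ I := by
    have := I.neg_mem hr
    simpa [hr0'] using this
  have : ∀ c ∈ I, ∃ h : A →ₗ[C] C, h 1 = c := by
    intro c hc
    refine Submodule.span_induction (p := fun c _ => ∃ h : A →ₗ[C] C, h 1 = c) ?_ ?_ ?_ ?_ hc
    · rintro _ h; exact h
    · exact ⟨0, rfl⟩
    · rintro _ _ _ _ ⟨h, rfl⟩ ⟨k, rfl⟩; exact ⟨h + k, rfl⟩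
    · rintro c _ _ ⟨h, rfl⟩; exact ⟨c • h, rfl⟩
  exact this 1 h1

-- The tensors are the preimages of `x ↦ f i x • 1` under the isomorphism of `A ⊗ Aᵐᵒᵖ` with the
-- endomorphisms of `A`. By injectivity the required identities in `A ⊗ A` may be checked on
-- endomorphisms, where they are the dual basis formula and the centrality of scalars.
variable (C A) in
theorem IsAzumaya.nonempty_azumayaFrame [IsAzumaya C A] : Nonempty (AzumayaFrame C A) := by
  obtain ⟨n, g, f, -, -, hfg⟩ := Module.Finite.exists_comp_eq_id_of_projective C A
  obtain ⟨f₀, hf₀⟩ := exists_linearMap_apply_one_eq_one C A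
  let σ : A ⊗[C] A ≃ₗ[C] A ⊗[C] Aᵐᵒᵖ :=
    TensorProduct.congr (LinearEquiv.refl C A) (MulOpposite.opLinearEquiv C)
  have hσ : ∀ τ x, AlgHom.mulLeftRight C A (σ τ) x = sandwich (AlgHom.id C A) τ x := by
    intro τ x
    induction τ with
    | zero => simp
    | tmul p q => simp [σ]
    | add a b ha hb => simp [ha, hb]
  have hinj : ∀ τ τ' : A ⊗[C] A,
      (∀ x, sandwich (AlgHom.id C A) τ x = sandwich (AlgHom.id C A) τ' x) → τ = τ' := by
    intro τ τ' h
    apply σ.injective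
    apply (IsAzumaya.bij (R := C) (A := A)).1
    ext x
    rw [hσ, hσ, h]
  choose τ hτ using fun i : Fin n =>
    (IsAzumaya.bij (R := C) (A := A)).2
      (Algebra.linearMap C A ∘ₗ (LinearMap.proj i : (Fin n → C) →ₗ[C] C) ∘ₗ f)
  have hs : ∀ i x, sandwich (AlgHom.id C A) (σ.symm (τ i)) x = algebraMap C A (f x i) := by
    intro i x
    rw [← hσ, LinearEquiv.apply_symm_apply, hτ]
    rfl
  refine ⟨⟨n, fun i => g (Pi.single i 1), fun i => LinearMap.proj i ∘ₗ f,
    fun i => σ.symm (τ i), f₀, ?_, hs, ?_, hf₀⟩⟩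
  · apply hinj
    intro x
    rw [map_sum, LinearMap.sum_apply, Algebra.TensorProduct.one_def, sandwich_tmul]
    simp only [sandwich_tmul_one_mul, hs, map_one, one_mul, mul_one, AlgHom.id_apply]
    conv_rhs => rw [← LinearMap.id_apply (R := C) x, ← hfg, LinearMap.comp_apply]
    conv_rhs => rw [← LinearMap.sum_single_apply (fun _ => C) (f x)]
    rw [map_sum]
    refine Finset.sum_congr rfl fun i _ => ?_
    rw [← Algebra.commutes, ← Algebra.smul_def, ← map_smul]
    congr 1
    ext j
    simp [Pi.single_apply]
  · intro i x
    apply hinj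
    intro y
    rw [sandwich_tmul_one_mul, sandwich_mul_one_tmul, hs]
    exact (Algebra.commutes _ _).symm

namespace AzumayaFrame

section Centralizer

variable (F : AzumayaFrame C A) (φ : A →ₐ[C] T)

/-- Each tensor therefore maps all of `T` into the centralizer of `A`. -/
theorem commute_sandwich (i : Fin F.rank) (t : T) (a : A) :
    φ a * sandwich φ (F.tensor i) t = sandwich φ (F.tensor i) t * φ a := by
  rw [← sandwich_tmul_one_mul, ← sandwich_mul_one_tmul, F.tmul_one_mul_tensor]

theorem sum_mul_sandwich (t : T) : ∑ i, φ (F.vec i) * sandwich φ (F.tensor i) t = t := by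
  have h := congrArg (fun τ => sandwich φ τ t) F.sum_vec_mul_tensor
  simpa only [map_sum, LinearMap.sum_apply, sandwich_tmul_one_mul,
    Algebra.TensorProduct.one_def, sandwich_tmul, map_one, one_mul, mul_one] using h

theorem sandwich_tensor_apply (i : Fin F.rank) (x : A) :
    sandwich φ (F.tensor i) (φ x) = algebraMap C T (F.form i x) := by
  have h := sandwich_comp (AlgHom.id C A) φ (F.tensor i) x
  rwa [AlgHom.comp_id, F.sandwich_tensor, AlgHom.commutes] at h

theorem sum_form_smul (x : A) : ∑ i, F.form i x • F.vec i = x := by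
  have h := F.sum_mul_sandwich (AlgHom.id C A) x
  simpa only [F.sandwich_tensor, AlgHom.id_apply, ← Algebra.commutes, ← Algebra.smul_def] using h

/-- The multiplication map from `A ⊗ T^A` to `T`. -/
def centralizerMul : A ⊗[C] Subalgebra.centralizer C (Set.range φ) →ₐ[C] T :=
  Algebra.TensorProduct.lift φ (Subalgebra.centralizer C (Set.range φ)).val
    (fun a t => (Subalgebra.mem_centralizer_iff C).1 t.2 _ ⟨a, rfl⟩)

@[simp]
theorem centralizerMul_tmul (a : A) (t : Subalgebra.centralizer C (Set.range φ)) :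
    centralizerMul φ (a ⊗ₜ t) = φ a * t :=
  Algebra.TensorProduct.lift_tmul _ _ _ _ _

include F in
theorem centralizerMul_bijective : Function.Bijective (centralizerMul φ) := by
  let θ (i : Fin F.rank) : T →ₗ[C] Subalgebra.centralizer C (Set.range φ) :=
    (sandwich φ (F.tensor i)).codRestrict
      (Subalgebra.toSubmodule (Subalgebra.centralizer C (Set.range φ))) (by
        intro t
        refine (Subalgebra.mem_centralizer_iff C).2 ?_
        rintro _ ⟨a, rfl⟩
        exact F.commute_sandwich φ i t a)
  -- The inverse is `t ↦ ∑ vec i ⊗ τ i (t)`, where `τ i` is the action of `tensor i`.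
  let inv : T →ₗ[C] A ⊗[C] Subalgebra.centralizer C (Set.range φ) :=
    ∑ i, TensorProduct.mk C _ _ (F.vec i) ∘ₗ θ i
  refine Function.bijective_iff_has_inverse.2 ⟨inv, ?_, ?_⟩
  · have : inv ∘ₗ (centralizerMul φ).toLinearMap = LinearMap.id := by
      refine TensorProduct.ext' fun a s => ?_
      have hs : ∀ a, φ a * (s : T) = s * φ a := fun a =>
        (Subalgebra.mem_centralizer_iff C).1 s.2 _ ⟨a, rfl⟩
      have hθ : ∀ i, θ i (φ a * s) = F.form i a • s := by
        intro i
        apply Subtype.ext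
        change sandwich φ (F.tensor i) (φ a * s) = F.form i a • (s : T)
        rw [sandwich_mul_of_commute φ hs, F.sandwich_tensor_apply, Algebra.smul_def]
      simp only [LinearMap.comp_apply, AlgHom.toLinearMap_apply, centralizerMul_tmul,
        LinearMap.sum_apply, inv, hθ,
        TensorProduct.mk_apply, LinearMap.id_apply, TensorProduct.tmul_smul]
      simp only [TensorProduct.smul_tmul', ← TensorProduct.sum_tmul, F.sum_form_smul]
    exact fun x => LinearMap.congr_fun this x
  · intro t
    simp only [inv, LinearMap.sum_apply, map_sum, LinearMap.comp_apply, TensorProduct.mk_apply,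
      centralizerMul_tmul]
    exact F.sum_mul_sandwich φ t

-- The coordinates `F.form i x` can be read off from `φ x` by letting the tensors act on `T`, so
-- only scalars could be lost.
include F in
theorem injective_of_algebraMap_injective (h : Function.Injective (algebraMap C T)) :
    Function.Injective φ := by
  rw [injective_iff_map_eq_zero]
  intro x hx
  rw [← F.sum_form_smul x]
  refine Finset.sum_eq_zero fun i _ => ?_
  have : F.form i x = 0 := by
    apply h
    rw [← F.sandwich_tensor_apply φ, hx, map_zero, map_zero]
  rw [this, zero_smul]

end Centralizer

section TensorProduct

variable (F : AzumayaFrame C A) {S : Type*} [Ring S] [Algebra C S]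

/-- The `S`-component of an element of `A ⊗ S` along the linear form with value `1` at `1`. -/
def component (S : Type*) [Ring S] [Algebra C S] : A ⊗[C] S →ₗ[C] S :=
  TensorProduct.lid C S ∘ₗ F.unitForm.rTensor S

@[simp]
theorem component_tmul (a : A) (s : S) : F.component S (a ⊗ₜ s) = F.unitForm a • s := by
  simp [component]

include F in
theorem one_tmul_injective : Function.Injective fun s : S => (1 : A) ⊗ₜ[C] s := by
  intro s s' h
  have := congrArg (F.component S) h
  simpa [F.unitForm_one] using this

/-- The tensors send all of `A ⊗ S` into `1 ⊗ S`, but on an element commuting with `A` they act as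
the scalars `F.form i 1`. A combination of these scalars equals `1`. -/
theorem eq_one_tmul_component {t : A ⊗[C] S} (h : ∀ a : A, (a ⊗ₜ 1) * t = t * (a ⊗ₜ 1)) :
    t = 1 ⊗ₜ F.component S t := by
  let φ : A →ₐ[C] A ⊗[C] S := Algebra.TensorProduct.includeLeft
  have h₁ : ∀ i, sandwich φ (F.tensor i) t = F.form i 1 • t := by
    intro i
    have := sandwich_mul_of_commute φ h (F.tensor i) 1
    rwa [one_mul, ← map_one φ, F.sandwich_tensor_apply, ← Algebra.smul_def] at this
  have h₂ : ∀ i (t : A ⊗[C] S), sandwich φ (F.tensor i) t =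
      1 ⊗ₜ TensorProduct.lid C S ((F.form i).rTensor S t) := by
    intro i t
    induction t with
    | zero => simp
    | add a b ha hb => simp only [map_add, ha, hb, TensorProduct.tmul_add]
    | tmul a s =>
      have hs : ∀ a, φ a * (1 ⊗ₜ s) = (1 ⊗ₜ s) * φ a := fun a => by simp [φ]
      have : a ⊗ₜ[C] s = φ a * 1 ⊗ₜ s := by simp [φ]
      rw [this, sandwich_mul_of_commute φ hs, F.sandwich_tensor_apply, ← Algebra.smul_def]
      simp [φ]
  have h₃ : ∑ i, F.unitForm (F.vec i) * F.form i 1 = 1 := by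
    have := congrArg F.unitForm (F.sum_form_smul 1)
    rw [map_sum, F.unitForm_one] at this
    simpa [mul_comm] using this
  have h₄ : t = 1 ⊗ₜ ∑ i, F.unitForm (F.vec i) •
      TensorProduct.lid C S ((F.form i).rTensor S t) := by
    conv_lhs => rw [← one_smul C t, ← h₃, Finset.sum_smul]
    rw [TensorProduct.tmul_sum]
    refine Finset.sum_congr rfl fun i _ => ?_
    rw [mul_smul, ← h₁, h₂, TensorProduct.tmul_smul]
  rw [h₄]
  simp [F.unitForm_one]

end TensorProduct

section BaseChange

variable (F : AzumayaFrame C A) (D : Type*) [CommRing D] [Algebra C D]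

variable (C A) in
/-- The canonical map `A ⊗ A → (D ⊗ A) ⊗ (D ⊗ A)`. -/
def tensorBaseChange : A ⊗[C] A →ₐ[C] (D ⊗[C] A) ⊗[D] (D ⊗[C] A) :=
  Algebra.TensorProduct.lift
    (((Algebra.TensorProduct.includeLeft :
        D ⊗[C] A →ₐ[D] (D ⊗[C] A) ⊗[D] (D ⊗[C] A)).restrictScalars C).comp
      Algebra.TensorProduct.includeRight)
    (((Algebra.TensorProduct.includeRight :
        D ⊗[C] A →ₐ[D] (D ⊗[C] A) ⊗[D] (D ⊗[C] A)).restrictScalars C).comp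
      Algebra.TensorProduct.includeRight)
    (fun a b => by simp [commute_iff_eq])

@[simp]
theorem tensorBaseChange_tmul (a b : A) :
    tensorBaseChange C A D (a ⊗ₜ b) = (1 ⊗ₜ a) ⊗ₜ (1 ⊗ₜ b) :=
  (Algebra.TensorProduct.lift_tmul _ _ _ _ _).trans (by simp)

theorem sandwich_tensorBaseChange (τ : A ⊗[C] A) (d : D) (x : A) :
    sandwich (AlgHom.id D (D ⊗[C] A)) (tensorBaseChange C A D τ) (d ⊗ₜ x) =
      d ⊗ₜ sandwich (AlgHom.id C A) τ x := by
  induction τ with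
  | zero => simp
  | tmul p q => simp
  | add a b ha hb => simp only [map_add, LinearMap.add_apply, ha, hb, TensorProduct.tmul_add]

/-- The base change of a frame along `C → D`. -/
def baseChange : AzumayaFrame D (D ⊗[C] A) where
  rank := F.rank
  vec i := 1 ⊗ₜ F.vec i
  form i := (TensorProduct.AlgebraTensorModule.rid C D D).toLinearMap ∘ₗ (F.form i).baseChange D
  tensor i := tensorBaseChange C A D (F.tensor i)
  unitForm := (TensorProduct.AlgebraTensorModule.rid C D D).toLinearMap ∘ₗ F.unitForm.baseChange D
  sum_vec_mul_tensor := by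
    have h := congrArg (tensorBaseChange C A D) F.sum_vec_mul_tensor
    simpa only [map_sum, map_mul, tensorBaseChange_tmul, map_one,
      ← Algebra.TensorProduct.one_def] using h
  sandwich_tensor i x := by
    induction x with
    | zero => simp
    | add a b ha hb => simp only [map_add, ha, hb]
    | tmul d x =>
      rw [sandwich_tensorBaseChange, F.sandwich_tensor]
      simp [Algebra.algebraMap_eq_smul_one, TensorProduct.smul_tmul', Algebra.TensorProduct.one_def]
  tmul_one_mul_tensor i x := by
    induction x with
    | zero => simp
    | add a b ha hb => simp only [TensorProduct.add_tmul, TensorProduct.tmul_add, add_mul, mul_add,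
        ha, hb]
    | tmul d x =>
      have h := congrArg (tensorBaseChange C A D) (F.tmul_one_mul_tensor i x)
      simp only [map_mul, tensorBaseChange_tmul] at h
      have hd : d ⊗ₜ[C] x = d • (1 ⊗ₜ x) := by simp [TensorProduct.smul_tmul']
      rw [hd, ← TensorProduct.smul_tmul', TensorProduct.tmul_smul, smul_mul_assoc, mul_smul_comm,
        Algebra.TensorProduct.one_def, h]
  unitForm_one := by simp [Algebra.TensorProduct.one_def, F.unitForm_one]

end BaseChange

end AzumayaFrame
end Frame

/-! ### Functoriality of the coproduct. -/

namespace AlgCoprod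

variable {C : Type*} [CommRing C] {R : Type*} [Ring R] [Algebra C R] {A : Type*} [Ring A]
  [Algebra C A] {T : Type*} [Ring T] [Algebra C T]

theorem lift_mem (f : R →ₐ[C] T) (g : A →ₐ[C] T) (S : Subalgebra C T) (hf : ∀ r, f r ∈ S)
    (hg : ∀ a, g a ∈ S) (t : AlgCoprod C R A) : lift f g t ∈ S := by
  have : lift f g = S.val.comp (lift (f.codRestrict S hf) (g.codRestrict S hg)) :=
    hom_ext (by simp) (by simp)
  rw [this]
  exact (lift (f.codRestrict S hf) (g.codRestrict S hg) t).2

variable {R' : Type*} [Ring R'] [Algebra C R'] {A' : Type*} [Ring A'] [Algebra C A']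

@[simp]
theorem map_inl (f : R →ₐ[C] R') (g : A →ₐ[C] A') (r : R) :
    map f g (inl C R A r) = inl C R' A' (f r) := by
  simp [map]

@[simp]
theorem map_inr (f : R →ₐ[C] R') (g : A →ₐ[C] A') (a : A) :
    map f g (inr C R A a) = inr C R' A' (g a) := by
  simp [map]

end AlgCoprod

/-! ### The root algebra as left adjoint of `A ⊗ -`. -/

namespace RootAlgebra

section

variable {C : Type*} [CommRing C] {A : Type*} [Ring A] [Algebra C A] {R : Type*} [Ring R]
  [Algebra C R] {R' : Type*} [Ring R'] [Algebra C R'] {S : Type*} [Ring S] [Algebra C S]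

theorem commute_inr (t : RootAlgebra C A R) (a : A) :
    AlgCoprod.inr C R A a * t = t * AlgCoprod.inr C R A a :=
  (Subalgebra.mem_centralizer_iff C).1 t.2 _ ⟨a, rfl⟩

theorem mem_rootSubalgebra_iff {t : AlgCoprod C R A} :
    t ∈ rootSubalgebra C A R ↔ ∀ a, AlgCoprod.inr C R A a * t = t * AlgCoprod.inr C R A a :=
  (Subalgebra.mem_centralizer_iff C).trans Set.forall_mem_range

@[simp]
theorem mulMap_tmul (a : A) (t : RootAlgebra C A R) :
    mulMap C A R (a ⊗ₜ t) = AlgCoprod.inr C R A a * t :=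
  Algebra.TensorProduct.lift_tmul _ _ _ _ _

@[simp]
theorem coe_map (g : R →ₐ[C] R') (t : RootAlgebra C A R) :
    (map A g t : AlgCoprod C R' A) = AlgCoprod.map g (AlgHom.id C A) t := rfl

theorem mulMap_map (g : R →ₐ[C] R') (t : A ⊗[C] RootAlgebra C A R) :
    mulMap C A R' (Algebra.TensorProduct.map (AlgHom.id C A) (map A g) t) =
      AlgCoprod.map g (AlgHom.id C A) (mulMap C A R t) := by
  induction t with
  | zero => simp
  | tmul a t => simp
  | add a b ha hb => simp only [_root_.map_add, ha, hb]

variable (F : AzumayaFrame C A)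

include F in
theorem mulMap_bijective : Function.Bijective (mulMap C A R) :=
  F.centralizerMul_bijective (AlgCoprod.inr C R A)

variable (R) in
/-- The multiplication map as an isomorphism. -/
def mulEquiv : A ⊗[C] RootAlgebra C A R ≃ₐ[C] AlgCoprod C R A :=
  AlgEquiv.ofBijective (mulMap C A R) (mulMap_bijective F)

@[simp]
theorem mulEquiv_symm_inr (a : A) : (mulEquiv R F).symm (AlgCoprod.inr C R A a) = a ⊗ₜ 1 := by
  rw [AlgEquiv.symm_apply_eq]
  exact ((mulMap_tmul a 1).trans (mul_one _)).symm

@[simp]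
theorem mulEquiv_symm_coe (t : RootAlgebra C A R) :
    (mulEquiv R F).symm (t : AlgCoprod C R A) = 1 ⊗ₜ t := by
  rw [AlgEquiv.symm_apply_eq]
  exact ((mulMap_tmul 1 t).trans (by simp)).symm

variable (R) in
/-- The universal map `R → A ⊗ RootAlgebra C A R`. -/
def unit : R →ₐ[C] A ⊗[C] RootAlgebra C A R :=
  (mulEquiv R F).symm.toAlgHom.comp (AlgCoprod.inl C R A)

@[simp]
theorem mulMap_unit (r : R) : mulMap C A R (unit R F r) = AlgCoprod.inl C R A r :=
  (mulEquiv R F).apply_symm_apply _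

theorem isUniversalMap_unit : IsUniversalMap (unit R F) := mulMap_unit F

theorem IsUniversalMap.eq_unit {η : R →ₐ[C] A ⊗[C] RootAlgebra C A R} (h : IsUniversalMap η) :
    η = unit R F :=
  AlgHom.ext fun r => (mulMap_bijective F).1 ((h r).trans (mulMap_unit F r).symm)

theorem map_comp_unit (g : R →ₐ[C] R') :
    (Algebra.TensorProduct.map (AlgHom.id C A) (map A g)).comp (unit R F) =
      (unit R' F).comp g :=
  AlgHom.ext fun r => (mulMap_bijective F).1 <| by simp [mulMap_map]

/-- The homomorphism `RootAlgebra C A R → S` which corresponds to `R → A ⊗ S`. -/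
def desc (h : R →ₐ[C] A ⊗[C] S) : RootAlgebra C A R →ₐ[C] S :=
  -- The lift `R ∗ A → A ⊗ S` sends the centralizer of `A` into the centralizer of `A` in `A ⊗ S`,
  -- which is `1 ⊗ S`; so taking the component loses nothing and is multiplicative there.
  have key : ∀ t : RootAlgebra C A R,
      AlgCoprod.lift h Algebra.TensorProduct.includeLeft (t : AlgCoprod C R A) = (1 : A) ⊗ₜ[C]
        F.component S (AlgCoprod.lift h Algebra.TensorProduct.includeLeft (t : AlgCoprod C R A)) :=
    fun t => F.eq_one_tmul_component fun a => by
      have := congrArg (AlgCoprod.lift h Algebra.TensorProduct.includeLeft) (commute_inr t a)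
      simpa using this
  AlgHom.ofLinearMap
    (F.component S ∘ₗ
      ((AlgCoprod.lift h Algebra.TensorProduct.includeLeft).comp
        (rootSubalgebra C A R).val).toLinearMap)
    (by simp [Algebra.TensorProduct.one_def, F.unitForm_one])
    (fun s t => F.one_tmul_injective <| by
      have hs := key s
      have ht := key t
      have hst := key (s * t)
      simp only [LinearMap.comp_apply, AlgHom.toLinearMap_apply, AlgHom.comp_apply,
        Subalgebra.coe_val] at *
      rw [← hst, ← mul_one (1 : A), ← Algebra.TensorProduct.tmul_mul_tmul, ← hs, ← ht,
        Subalgebra.coe_mul, map_mul])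

theorem one_tmul_desc (h : R →ₐ[C] A ⊗[C] S) (t : RootAlgebra C A R) :
    (1 : A) ⊗ₜ[C] desc F h t =
      AlgCoprod.lift h Algebra.TensorProduct.includeLeft (t : AlgCoprod C R A) :=
  (F.eq_one_tmul_component fun a => by
      have := congrArg (AlgCoprod.lift h Algebra.TensorProduct.includeLeft) (commute_inr t a)
      simpa using this).symm

theorem map_desc (h : R →ₐ[C] A ⊗[C] S) (t : A ⊗[C] RootAlgebra C A R) :
    Algebra.TensorProduct.map (AlgHom.id C A) (desc F h) t =
      AlgCoprod.lift h Algebra.TensorProduct.includeLeft (mulMap C A R t) := by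
  induction t with
  | zero => simp
  | add a b ha hb => simp only [_root_.map_add, ha, hb]
  | tmul a t =>
    rw [mulMap_tmul, map_mul, ← one_tmul_desc F]
    simp

theorem map_desc_comp_unit (h : R →ₐ[C] A ⊗[C] S) :
    (Algebra.TensorProduct.map (AlgHom.id C A) (desc F h)).comp (unit R F) = h :=
  AlgHom.ext fun r => by simp [map_desc]

/-- Uniqueness in the adjunction: through `A ⊗ RootAlgebra C A R ≃ R ∗ A`, the map `id ⊗ χ` is
determined on `A` in any case and on `R` by its composite with the unit. -/
theorem hom_ext_of_map_comp_unit {φ ψ : RootAlgebra C A R →ₐ[C] S}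
    (h : (Algebra.TensorProduct.map (AlgHom.id C A) φ).comp (unit R F) =
      (Algebra.TensorProduct.map (AlgHom.id C A) ψ).comp (unit R F)) : φ = ψ := by
  have key : ∀ χ : RootAlgebra C A R →ₐ[C] S,
      (Algebra.TensorProduct.map (AlgHom.id C A) χ).comp (mulEquiv R F).symm.toAlgHom =
        AlgCoprod.lift ((Algebra.TensorProduct.map (AlgHom.id C A) χ).comp (unit R F))
          Algebra.TensorProduct.includeLeft := by
    intro χ
    refine AlgCoprod.hom_ext (fun r => ?_) (fun a => ?_)
    · rw [AlgCoprod.lift_inl]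
      rfl
    · simp
  ext t
  apply F.one_tmul_injective
  have h₁ := DFunLike.congr_fun (key φ) (t : AlgCoprod C R A)
  have h₂ := DFunLike.congr_fun (key ψ) (t : AlgCoprod C R A)
  rw [h, ← h₂] at h₁
  simpa using h₁

end

/-! ### Functoriality in the Azumaya algebra. -/

section Induced

variable {C : Type*} [CommRing C] {A : Type*} [Ring A] [Algebra C A] {B : Type*} [Ring B]
  [Algebra C B] {R : Type*} [Ring R] [Algebra C R] {R' : Type*} [Ring R'] [Algebra C R']
  (F : AzumayaFrame C A) (G : AzumayaFrame C B) (f : A →ₐ[C] B)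

variable (R) in
/-- The map of root algebras induced by a homomorphism `A → B`. -/
def induced : RootAlgebra C B R →ₐ[C] RootAlgebra C A R :=
  desc G ((Algebra.TensorProduct.map f (AlgHom.id C (RootAlgebra C A R))).comp (unit R F))

theorem map_induced_comp_unit :
    (Algebra.TensorProduct.map (AlgHom.id C B) (induced R F G f)).comp (unit R G) =
      (Algebra.TensorProduct.map f (AlgHom.id C (RootAlgebra C A R))).comp (unit R F) :=
  map_desc_comp_unit G _

theorem isInducedBy_induced : IsInducedBy f (induced R F G f) :=
  ⟨unit R F, unit R G, isUniversalMap_unit F, isUniversalMap_unit G, map_induced_comp_unit F G f⟩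

variable {f} in
theorem IsInducedBy.eq_induced {φ : RootAlgebra C B R →ₐ[C] RootAlgebra C A R}
    (h : IsInducedBy f φ) : φ = induced R F G f := by
  obtain ⟨ηA, ηB, hA, hB, h⟩ := h
  rw [hA.eq_unit F, hB.eq_unit G] at h
  exact hom_ext_of_map_comp_unit G (h.trans (map_induced_comp_unit F G f).symm)

/-- Both sides have the same adjoint `R → B ⊗ RootAlgebra C A R'`, by naturality of the unit and
because `f ⊗ id` commutes with `id ⊗ map A g`. -/
theorem induced_comp_map (g : R →ₐ[C] R') :
    (induced R' F G f).comp (map B g) = (map A g).comp (induced R F G f) := by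
  apply hom_ext_of_map_comp_unit G
  have key : (Algebra.TensorProduct.map f (AlgHom.id C (RootAlgebra C A R'))).comp
      (Algebra.TensorProduct.map (AlgHom.id C A) (map A g)) =
      (Algebra.TensorProduct.map (AlgHom.id C B) (map A g)).comp
        (Algebra.TensorProduct.map f (AlgHom.id C (RootAlgebra C A R))) := by
    rw [← Algebra.TensorProduct.map_comp, ← Algebra.TensorProduct.map_comp]
    rfl
  rw [Algebra.TensorProduct.map_id_comp, Algebra.TensorProduct.map_id_comp, AlgHom.comp_assoc,
    AlgHom.comp_assoc, map_comp_unit G, map_induced_comp_unit F G, ← AlgHom.comp_assoc,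
    map_induced_comp_unit F G, AlgHom.comp_assoc, ← map_comp_unit F, ← AlgHom.comp_assoc, key,
    AlgHom.comp_assoc]

end Induced

end RootAlgebra

/-! ### Iterated roots; an algebra `E` isomorphic to `A ⊗ B` serves both orders of the factors. -/

namespace RootAlgebra

section Iterate

variable {C : Type*} [CommRing C] {A : Type*} [Ring A] [Algebra C A] {B : Type*} [Ring B]
  [Algebra C B] {E : Type*} [Ring E] [Algebra C E] {R : Type*} [Ring R] [Algebra C R]
  {R' : Type*} [Ring R'] [Algebra C R'] {i : A →ₐ[C] E} {j : B →ₐ[C] E}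

@[simp]
theorem iterateMap_inl (i : A →ₐ[C] E) (j : B →ₐ[C] E) (t : RootAlgebra C B R) :
    iterateMap R i j (AlgCoprod.inl C _ A t) = AlgCoprod.map (AlgHom.id C R) j t := by
  simp [iterateMap]

@[simp]
theorem iterateMap_inr (i : A →ₐ[C] E) (j : B →ₐ[C] E) (a : A) :
    iterateMap R i j (AlgCoprod.inr C (RootAlgebra C B R) A a) = AlgCoprod.inr C R E (i a) := by
  simp [iterateMap]

/-- The image of `B` commutes with both generating pieces: with the root algebra by definition of
the centralizer, with `A` by hypothesis. -/
theorem commute_iterateMap (hij : ∀ a b, Commute (i a) (j b)) (b : B)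
    (w : AlgCoprod C (RootAlgebra C B R) A) :
    Commute (AlgCoprod.inr C R E (j b)) (iterateMap R i j w) := by
  have := AlgCoprod.lift_mem ((AlgCoprod.map (AlgHom.id C R) j).comp (rootSubalgebra C B R).val)
    ((AlgCoprod.inr C R E).comp i) (Subalgebra.centralizer C {AlgCoprod.inr C R E (j b)})
    (fun t => by
      rw [Subalgebra.mem_centralizer_iff]
      rintro _ rfl
      have := congrArg (AlgCoprod.map (AlgHom.id C R) j) (commute_inr t b)
      simpa using this)
    (fun a => by
      rw [Subalgebra.mem_centralizer_iff]
      rintro _ rfl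
      simp only [AlgHom.comp_apply]
      rw [← map_mul, ← (hij a b).eq, map_mul]) w
  exact (Subalgebra.mem_centralizer_iff C).1 this _ rfl

variable (R) in
/-- The multiplication map `B ⊗ (RootAlgebra C B R ∗ A) → R ∗ E`. -/
def mulIterateMap (hij : ∀ a b, Commute (i a) (j b)) :
    B ⊗[C] AlgCoprod C (RootAlgebra C B R) A →ₐ[C] AlgCoprod C R E :=
  Algebra.TensorProduct.lift ((AlgCoprod.inr C R E).comp j) (iterateMap R i j)
    (commute_iterateMap hij)

@[simp]
theorem mulIterateMap_tmul (hij : ∀ a b, Commute (i a) (j b)) (b : B)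
    (w : AlgCoprod C (RootAlgebra C B R) A) :
    mulIterateMap R hij (b ⊗ₜ w) = AlgCoprod.inr C R E (j b) * iterateMap R i j w :=
  Algebra.TensorProduct.lift_tmul _ _ _ _ _

variable (G : AzumayaFrame C B) (π : E ≃ₐ[C] A ⊗[C] B)

variable (R) in
/-- The inverse of `mulIterateMap`. -/
def mulIterateInv : AlgCoprod C R E →ₐ[C] B ⊗[C] AlgCoprod C (RootAlgebra C B R) A :=
  AlgCoprod.lift
    ((Algebra.TensorProduct.map (AlgHom.id C B) (AlgCoprod.inl C (RootAlgebra C B R) A)).comp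
      (unit R G))
    ((Algebra.TensorProduct.map (AlgHom.id C B) (AlgCoprod.inr C (RootAlgebra C B R) A)).comp
      ((Algebra.TensorProduct.comm C A B).toAlgHom.comp π.toAlgHom))

variable (hi : ∀ a, π (i a) = a ⊗ₜ 1) (hj : ∀ b, π (j b) = 1 ⊗ₜ b)

include hi in
theorem mulIterateInv_inr_left (a : A) :
    mulIterateInv R G π (AlgCoprod.inr C R E (i a)) = 1 ⊗ₜ AlgCoprod.inr C _ A a := by
  simp [mulIterateInv, hi]

include hj in
theorem mulIterateInv_inr_right (b : B) :
    mulIterateInv R G π (AlgCoprod.inr C R E (j b)) = b ⊗ₜ 1 := by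
  simp [mulIterateInv, hj]

include hj in
theorem mulIterateInv_map (t : AlgCoprod C R B) :
    mulIterateInv R G π (AlgCoprod.map (AlgHom.id C R) j t) =
      Algebra.TensorProduct.map (AlgHom.id C B) (AlgCoprod.inl C (RootAlgebra C B R) A)
        ((mulEquiv R G).symm t) := by
  have : (mulIterateInv R G π).comp (AlgCoprod.map (AlgHom.id C R) j) =
      (Algebra.TensorProduct.map (AlgHom.id C B) (AlgCoprod.inl C (RootAlgebra C B R) A)).comp
        (mulEquiv R G).symm.toAlgHom := by
    refine AlgCoprod.hom_ext (fun r => ?_) (fun b => ?_)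
    · simp [mulIterateInv, unit]
    · simp [mulIterateInv_inr_right G π hj]
  exact DFunLike.congr_fun this t

-- Besides being half of the inverse property, this makes `iterateMap` injective, because `w ↦ 1 ⊗
-- w` is.
include hi hj in
theorem mulIterateInv_iterateMap (w : AlgCoprod C (RootAlgebra C B R) A) :
    mulIterateInv R G π (iterateMap R i j w) = 1 ⊗ₜ w := by
  have : (mulIterateInv R G π).comp (iterateMap R i j) = Algebra.TensorProduct.includeRight := by
    refine AlgCoprod.hom_ext (fun t => ?_) (fun a => ?_)
    · simp [mulIterateInv_map G π hj]
    · simp [mulIterateInv_inr_left G π hi]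
  exact DFunLike.congr_fun this w

include hi hj in
theorem commute_of_equiv (a : A) (b : B) : Commute (i a) (j b) :=
  π.injective (by simp [hi, hj])

theorem mulIterateMap_mulIterateInv (t : AlgCoprod C R E) :
    mulIterateMap R (commute_of_equiv π hi hj) (mulIterateInv R G π t) = t := by
  have hij := commute_of_equiv π hi hj
  have h₁ : ∀ s : B ⊗[C] RootAlgebra C B R, mulIterateMap R hij
      (Algebra.TensorProduct.map (AlgHom.id C B) (AlgCoprod.inl C (RootAlgebra C B R) A) s) =
        AlgCoprod.map (AlgHom.id C R) j (mulMap C B R s) := by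
    intro s
    induction s with
    | zero => simp
    | add a b ha hb => simp only [_root_.map_add, ha, hb]
    | tmul b s => simp
  have h₂ : ∀ s : A ⊗[C] B, mulIterateMap R hij
      (Algebra.TensorProduct.map (AlgHom.id C B) (AlgCoprod.inr C (RootAlgebra C B R) A)
        (Algebra.TensorProduct.comm C A B s)) = AlgCoprod.inr C R E (π.symm s) := by
    intro s
    induction s with
    | zero => simp
    | add a b ha hb => simp only [_root_.map_add, ha, hb]
    | tmul a b =>
      have : π.symm (a ⊗ₜ b) = j b * i a := by
        rw [AlgEquiv.symm_apply_eq, map_mul, hi, hj]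
        simp
      rw [this]
      simp
  have : (mulIterateMap R hij).comp (mulIterateInv R G π) = AlgHom.id C _ := by
    refine AlgCoprod.hom_ext (fun r => ?_) (fun x => ?_)
    · simp [mulIterateInv, h₁]
    · simp [mulIterateInv, h₂]
  exact DFunLike.congr_fun this t

variable (R) in
/-- The composition of roots: if `A ⊗ B ≃ E`, then the root algebra for `A` of the root algebra
for `B` of `R` is the root algebra for `E` of `R`. -/
def iterateEquiv : RootAlgebra C A (RootAlgebra C B R) ≃ₐ[C] RootAlgebra C E R :=
  have hinj : Function.Injective (iterateMap R i j) := fun w w' h => by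
    apply G.one_tmul_injective
    simp only [← mulIterateInv_iterateMap G π hi hj, h]
  AlgEquiv.ofBijective
    (((iterateMap R i j).comp (rootSubalgebra C A (RootAlgebra C B R)).val).codRestrict
      (rootSubalgebra C E R) (by
        intro t
        rw [mem_rootSubalgebra_iff]
        intro x
        obtain ⟨s, rfl⟩ := π.symm.surjective x
        induction s with
        | zero => simp
        | add a b ha hb => simp only [_root_.map_add, add_mul, mul_add, ha, hb]
        | tmul a b =>
          have : π.symm (a ⊗ₜ b) = i a * j b := by
            rw [AlgEquiv.symm_apply_eq, map_mul, hi, hj]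
            simp
          have ht := congrArg (iterateMap R i j) (commute_inr t a)
          simp only [map_mul, iterateMap_inr] at ht
          simp only [AlgHom.comp_apply, Subalgebra.coe_val, this, map_mul]
          rw [mul_assoc, (commute_iterateMap (commute_of_equiv π hi hj) b _).eq, ← mul_assoc, ht,
            mul_assoc]))
    (by
      refine ⟨fun s t h => Subtype.ext (hinj (congrArg Subtype.val h)), fun t => ?_⟩
      have ht := fun x => commute_inr t x
      -- Surjectivity: an element centralizing `E` centralizes `B`, hence comes from some `1 ⊗ w`;
      -- centralizing `A` as well then puts `w` in the iterated root.
      have hw : mulIterateInv R G π t = 1 ⊗ₜ G.component _ (mulIterateInv R G π t) := by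
        apply G.eq_one_tmul_component
        intro b
        rw [← mulIterateInv_inr_right G π hj, ← map_mul, ← map_mul, ht]
      have hw' : iterateMap R i j (G.component _ (mulIterateInv R G π t)) = t := by
        have := mulIterateMap_mulIterateInv G π hi hj (t : AlgCoprod C R E)
        rw [hw] at this
        simpa using this
      refine ⟨⟨G.component _ (mulIterateInv R G π t), ?_⟩, Subtype.ext hw'⟩
      rw [mem_rootSubalgebra_iff]
      intro a
      apply hinj
      rw [map_mul, map_mul, hw', iterateMap_inr, ht])

theorem iterateMap_map (i : A →ₐ[C] E) (j : B →ₐ[C] E) (g : R →ₐ[C] R')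
    (w : AlgCoprod C (RootAlgebra C B R) A) :
    iterateMap R' i j (AlgCoprod.map (map B g) (AlgHom.id C A) w) =
      AlgCoprod.map g (AlgHom.id C E) (iterateMap R i j w) := by
  have h : (AlgCoprod.map (AlgHom.id C R') j).comp (AlgCoprod.map g (AlgHom.id C B)) =
      (AlgCoprod.map g (AlgHom.id C E)).comp (AlgCoprod.map (AlgHom.id C R) j) :=
    AlgCoprod.hom_ext (by simp) (by simp)
  have : (iterateMap R' i j).comp (AlgCoprod.map (map B g) (AlgHom.id C A)) =
      (AlgCoprod.map g (AlgHom.id C E)).comp (iterateMap R i j) :=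
    AlgCoprod.hom_ext (fun t => by simpa using DFunLike.congr_fun h (t : AlgCoprod C R B)) (by simp)
  exact DFunLike.congr_fun this w

theorem iterateEquiv_map (g : R →ₐ[C] R') (t : RootAlgebra C A (RootAlgebra C B R)) :
    iterateEquiv R' G π hi hj (map A (map B g) t) = map E g (iterateEquiv R G π hi hj t) :=
  Subtype.ext (iterateMap_map i j g _)

end Iterate

end RootAlgebra

/-! ### Base change of coproducts and root algebras. -/

section BaseChange

variable {C : Type*} [CommRing C] {R : Type*} [Ring R] [Algebra C R] {A : Type*} [Ring A]
  [Algebra C A] {R' : Type*} [Ring R'] [Algebra C R'] (D : Type*) [CommRing D] [Algebra C D]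

namespace AlgCoprod

@[simp]
theorem baseChange_inl (r : R) :
    baseChange D (inl C R A r) = inl D (D ⊗[C] R) (D ⊗[C] A) (1 ⊗ₜ r) :=
  letI : Algebra C (AlgCoprod D (D ⊗[C] R) (D ⊗[C] A)) :=
    Algebra.compHom _ (algebraMap C D)
  lift_inl _ _ _

@[simp]
theorem baseChange_inr (a : A) :
    baseChange D (inr C R A a) = inr D (D ⊗[C] R) (D ⊗[C] A) (1 ⊗ₜ a) :=
  letI : Algebra C (AlgCoprod D (D ⊗[C] R) (D ⊗[C] A)) :=
    Algebra.compHom _ (algebraMap C D)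
  lift_inr _ _ _

theorem baseChange_algebraMap (c : C) :
    baseChange D (algebraMap C (AlgCoprod C R A) c) =
      algebraMap D (AlgCoprod D (D ⊗[C] R) (D ⊗[C] A)) (algebraMap C D c) := by
  rw [← (inl C R A).commutes, baseChange_inl, ← (inl D (D ⊗[C] R) (D ⊗[C] A)).commutes]
  simp [Algebra.algebraMap_eq_smul_one, Algebra.TensorProduct.one_def]

variable (C R A) in
/-- The comparison map `D ⊗ (R ∗_C A) → (D ⊗ R) ∗_D (D ⊗ A)`. -/
def baseChangeHom : D ⊗[C] AlgCoprod C R A →ₐ[D] AlgCoprod D (D ⊗[C] R) (D ⊗[C] A) :=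
  letI : Algebra C (AlgCoprod D (D ⊗[C] R) (D ⊗[C] A)) :=
    Algebra.compHom _ (algebraMap C D)
  haveI : IsScalarTower C D (AlgCoprod D (D ⊗[C] R) (D ⊗[C] A)) :=
    IsScalarTower.of_algebraMap_eq fun _ => rfl
  Algebra.TensorProduct.lift (Algebra.ofId D _)
    { baseChange (C := C) (R := R) (A := A) D with commutes' := baseChange_algebraMap D }
    (fun d _ => Algebra.commutes d _)

@[simp]
theorem baseChangeHom_tmul (d : D) (t : AlgCoprod C R A) :
    baseChangeHom C R A D (d ⊗ₜ t) = d • baseChange D t :=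
  letI : Algebra C (AlgCoprod D (D ⊗[C] R) (D ⊗[C] A)) :=
    Algebra.compHom _ (algebraMap C D)
  haveI : IsScalarTower C D (AlgCoprod D (D ⊗[C] R) (D ⊗[C] A)) :=
    IsScalarTower.of_algebraMap_eq fun _ => rfl
  (Algebra.TensorProduct.lift_tmul _ _ _ _ _).trans (Algebra.smul_def _ _).symm

variable (C R A) in
/-- The inverse of `baseChangeHom`. -/
def baseChangeInv : AlgCoprod D (D ⊗[C] R) (D ⊗[C] A) →ₐ[D] D ⊗[C] AlgCoprod C R A :=
  lift (Algebra.TensorProduct.map (AlgHom.id D D) (inl C R A))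
    (Algebra.TensorProduct.map (AlgHom.id D D) (inr C R A))

theorem baseChangeInv_baseChange (t : AlgCoprod C R A) :
    baseChangeInv C R A D (baseChange D t) = 1 ⊗ₜ t := by
  let : Algebra C (AlgCoprod D (D ⊗[C] R) (D ⊗[C] A)) :=
    Algebra.compHom _ (algebraMap C D)
  have : IsScalarTower C D (AlgCoprod D (D ⊗[C] R) (D ⊗[C] A)) :=
    IsScalarTower.of_algebraMap_eq fun _ => rfl
  have : ((baseChangeInv C R A D).restrictScalars C).comp
      (({ baseChange (C := C) (R := R) (A := A) D with commutes' := baseChange_algebraMap D } :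
        AlgCoprod C R A →ₐ[C] AlgCoprod D (D ⊗[C] R) (D ⊗[C] A))) =
      (Algebra.TensorProduct.includeRight : _ →ₐ[C] D ⊗[C] AlgCoprod C R A) := by
    refine hom_ext (fun r => ?_) (fun a => ?_)
    · change baseChangeInv C R A D (baseChange D (inl C R A r)) = 1 ⊗ₜ inl C R A r
      simp [baseChangeInv]
    · change baseChangeInv C R A D (baseChange D (inr C R A a)) = 1 ⊗ₜ inr C R A a
      simp [baseChangeInv]
  exact DFunLike.congr_fun this t

variable (C R A) in
/-- The coproduct commutes with base change. -/
def baseChangeEquiv : D ⊗[C] AlgCoprod C R A ≃ₐ[D] AlgCoprod D (D ⊗[C] R) (D ⊗[C] A) :=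
  AlgEquiv.ofAlgHom (baseChangeHom C R A D) (baseChangeInv C R A D)
    (by
      refine hom_ext (fun r => ?_) (fun a => ?_)
      · induction r with
        | zero => simp
        | add a b ha hb => simp only [_root_.map_add, ha, hb]
        | tmul d r =>
          simp [baseChangeInv, ← map_smul, TensorProduct.smul_tmul']
      · induction a with
        | zero => simp
        | add a b ha hb => simp only [_root_.map_add, ha, hb]
        | tmul d r =>
          simp [baseChangeInv, ← map_smul, TensorProduct.smul_tmul'])
    (by
      ext t
      simp [baseChangeInv_baseChange])

end AlgCoprod

namespace RootAlgebra

variable (F : AzumayaFrame C A)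

variable (R) in
/-- `A ⊗ (D ⊗ RootAlgebra C A R) ≃ D ⊗ (R ∗ A)`. -/
def leftCommEquiv : A ⊗[C] (D ⊗[C] RootAlgebra C A R) ≃ₐ[C] D ⊗[C] AlgCoprod C R A :=
  (Algebra.TensorProduct.leftComm C A D (RootAlgebra C A R)).trans
    (Algebra.TensorProduct.congr AlgEquiv.refl (mulEquiv R F))

theorem leftCommEquiv_tmul (a : A) (d : D) (t : RootAlgebra C A R) :
    leftCommEquiv R D F (a ⊗ₜ (d ⊗ₜ t)) = d ⊗ₜ (AlgCoprod.inr C R A a * t) := by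
  simp [leftCommEquiv, mulEquiv]

/-- This replaces flatness of `D`: the map from `D ⊗ RootAlgebra C A R` to `D ⊗ (R ∗ A)` is
identified with `s ↦ 1 ⊗ s`, which is split by the form with value `1` at `1`. -/
theorem leftCommEquiv_one_tmul (s : D ⊗[C] RootAlgebra C A R) :
    leftCommEquiv R D F (1 ⊗ₜ s) =
      Algebra.TensorProduct.map (AlgHom.id D D) (rootSubalgebra C A R).val s := by
  induction s with
  | zero => simp
  | add a b ha hb => simp only [_root_.map_add, TensorProduct.tmul_add, ha, hb]
  | tmul d t => simp [leftCommEquiv_tmul]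

variable (R) in
/-- The root algebra commutes with base change. -/
def baseChangeEquiv : D ⊗[C] RootAlgebra C A R ≃ₐ[D] RootAlgebra D (D ⊗[C] A) (D ⊗[C] R) :=
  AlgEquiv.ofBijective
    (((AlgCoprod.baseChangeEquiv C R A D).toAlgHom.comp
      (Algebra.TensorProduct.map (AlgHom.id D D) (rootSubalgebra C A R).val)).codRestrict
      (rootSubalgebra D (D ⊗[C] A) (D ⊗[C] R)) (by
        intro s
        rw [mem_rootSubalgebra_iff]
        intro x
        induction x with
        | zero => simp
        | add a b ha hb => simp only [_root_.map_add, add_mul, mul_add, ha, hb]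
        | tmul d a =>
          induction s with
          | zero => simp
          | add a b ha hb => simp only [_root_.map_add, add_mul, mul_add, ha, hb]
          | tmul d' t =>
            have hd : d ⊗ₜ[C] a = d • (1 ⊗ₜ a) := by simp [TensorProduct.smul_tmul']
            have h := congrArg (AlgCoprod.baseChange D) (commute_inr t a)
            simp only [map_mul, AlgCoprod.baseChange_inr] at h
            simp [hd, AlgCoprod.baseChangeEquiv, h, smul_comm d d']))
    (by
      refine ⟨fun s s' h => ?_, fun x => ?_⟩
      · have h' : Algebra.TensorProduct.map (AlgHom.id D D) (rootSubalgebra C A R).val s =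
            Algebra.TensorProduct.map (AlgHom.id D D) (rootSubalgebra C A R).val s' :=
          (AlgCoprod.baseChangeEquiv C R A D).injective (congrArg Subtype.val h)
        rw [← leftCommEquiv_one_tmul D F, ← leftCommEquiv_one_tmul D F] at h'
        exact F.one_tmul_injective ((leftCommEquiv R D F).injective h')
      · set y := (leftCommEquiv R D F).symm ((AlgCoprod.baseChangeEquiv C R A D).symm x) with hy
        have hx : (x : AlgCoprod D (D ⊗[C] R) (D ⊗[C] A)) =
            AlgCoprod.baseChangeEquiv C R A D (leftCommEquiv R D F y) := by simp [hy]
        -- Transported to `A ⊗ (D ⊗ RootAlgebra C A R)`, an element of the root algebra over `D`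
        -- commutes with `A`, so it lies in the second factor.
        have hc : y = 1 ⊗ₜ F.component _ y := by
          apply F.eq_one_tmul_component
          intro a
          apply (leftCommEquiv R D F).injective
          apply (AlgCoprod.baseChangeEquiv C R A D).injective
          have h := commute_inr x (1 ⊗ₜ a)
          have ha : AlgCoprod.inr D (D ⊗[C] R) (D ⊗[C] A) (1 ⊗ₜ a) =
              AlgCoprod.baseChangeEquiv C R A D (leftCommEquiv R D F (a ⊗ₜ 1)) := by
            rw [Algebra.TensorProduct.one_def, leftCommEquiv_tmul]
            simp [AlgCoprod.baseChangeEquiv]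
          rw [map_mul, map_mul, map_mul, map_mul, ← ha, ← hx, h]
        refine ⟨F.component _ y, Subtype.ext ?_⟩
        rw [hx, hc, leftCommEquiv_one_tmul]
        simp [F.unitForm_one])

@[simp]
theorem coe_baseChangeEquiv_tmul (d : D) (t : RootAlgebra C A R) :
    (baseChangeEquiv R D F (d ⊗ₜ t) : AlgCoprod D (D ⊗[C] R) (D ⊗[C] A)) =
      d • AlgCoprod.baseChange D (t : AlgCoprod C R A) :=
  AlgCoprod.baseChangeHom_tmul D d _

theorem _root_.AlgCoprod.baseChange_map (g : R →ₐ[C] R') (t : AlgCoprod C R A) :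
    AlgCoprod.baseChange D (AlgCoprod.map g (AlgHom.id C A) t) =
      AlgCoprod.map (Algebra.TensorProduct.map (AlgHom.id D D) g) (AlgHom.id D (D ⊗[C] A))
        (AlgCoprod.baseChange D t) := by
  apply (AlgCoprod.baseChangeEquiv C R' A D).symm.injective
  have h : ((AlgCoprod.baseChangeInv C R' A D).comp
      (AlgCoprod.map (Algebra.TensorProduct.map (AlgHom.id D D) g) (AlgHom.id D (D ⊗[C] A)))) =
      (Algebra.TensorProduct.map (AlgHom.id D D) (AlgCoprod.map g (AlgHom.id C A))).comp
        (AlgCoprod.baseChangeInv C R A D) := by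
    refine AlgCoprod.hom_ext (fun r => ?_) (fun a => ?_)
    · induction r with
      | zero => simp
      | add a b ha hb => simp only [_root_.map_add, ha, hb]
      | tmul d r => simp [AlgCoprod.baseChangeInv]
    · induction a with
      | zero => simp
      | add a b ha hb => simp only [_root_.map_add, ha, hb]
      | tmul d a => simp [AlgCoprod.baseChangeInv]
  have h' := DFunLike.congr_fun h (AlgCoprod.baseChange D t)
  change AlgCoprod.baseChangeInv C R' A D _ = AlgCoprod.baseChangeInv C R' A D _
  rw [AlgHom.comp_apply, AlgHom.comp_apply, AlgCoprod.baseChangeInv_baseChange] at h'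
  rw [AlgCoprod.baseChangeInv_baseChange, h']
  simp

theorem baseChangeEquiv_map (g : R →ₐ[C] R') (t : D ⊗[C] RootAlgebra C A R) :
    baseChangeEquiv R' D F (Algebra.TensorProduct.map (AlgHom.id D D) (map A g) t) =
      map (D ⊗[C] A) (Algebra.TensorProduct.map (AlgHom.id D D) g) (baseChangeEquiv R D F t) := by
  induction t with
  | zero => simp
  | add a b ha hb => simp only [_root_.map_add, ha, hb]
  | tmul d t =>
    apply Subtype.ext
    rw [coe_map, coe_baseChangeEquiv_tmul, map_smul, ← AlgCoprod.baseChange_map]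
    simp

end RootAlgebra

end BaseChange

/-! ### Transport along isomorphisms and the split case. -/

namespace RootAlgebra

section Congr

variable {C : Type*} [CommRing C] {A : Type*} [Ring A] [Algebra C A] {A' : Type*} [Ring A']
  [Algebra C A'] {R : Type*} [Ring R] [Algebra C R] {R' : Type*} [Ring R'] [Algebra C R']

/-- The map on root algebras given by an isomorphism `A ≃ A'` and a homomorphism `R → R'`. -/
def mapOfEquiv (α : A ≃ₐ[C] A') (g : R →ₐ[C] R') : RootAlgebra C A R →ₐ[C] RootAlgebra C A' R' :=
  ((AlgCoprod.map g α.toAlgHom).comp (rootSubalgebra C A R).val).codRestrict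
    (rootSubalgebra C A' R') (by
      intro t
      rw [mem_rootSubalgebra_iff]
      intro a
      obtain ⟨a, rfl⟩ := α.surjective a
      simpa using congrArg (AlgCoprod.map g α.toAlgHom) (commute_inr t a))

/-- Root algebras of isomorphic algebras are isomorphic. -/
def congr (α : A ≃ₐ[C] A') (ρ : R ≃ₐ[C] R') : RootAlgebra C A R ≃ₐ[C] RootAlgebra C A' R' :=
  AlgEquiv.ofAlgHom (mapOfEquiv α ρ.toAlgHom) (mapOfEquiv α.symm ρ.symm.toAlgHom)
    (by
      have key : (AlgCoprod.map ρ.toAlgHom α.toAlgHom).comp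
          (AlgCoprod.map ρ.symm.toAlgHom α.symm.toAlgHom) = AlgHom.id C _ :=
        AlgCoprod.hom_ext (by simp) (by simp)
      exact AlgHom.ext fun t => Subtype.ext
        (DFunLike.congr_fun key (t : AlgCoprod C R' A')))
    (by
      have key : (AlgCoprod.map ρ.symm.toAlgHom α.symm.toAlgHom).comp
          (AlgCoprod.map ρ.toAlgHom α.toAlgHom) = AlgHom.id C _ :=
        AlgCoprod.hom_ext (by simp) (by simp)
      exact AlgHom.ext fun t => Subtype.ext
        (DFunLike.congr_fun key (t : AlgCoprod C R A)))

end Congr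

section Matrix

variable (K D : Type*) [CommRing K] [CommRing D] [Algebra K D] (n : ℕ)

/-- `D ⊗ M_n(K) ≃ M_n(D)` as `D`-algebras. -/
def tensorMatrixEquiv :
    D ⊗[K] Matrix (Fin n) (Fin n) K ≃ₐ[D] Matrix (Fin n) (Fin n) D :=
  AlgEquiv.ofRingEquiv (f := (matrixEquivTensor (Fin n) K D).symm.toRingEquiv) (fun d => by
    change (matrixEquivTensor (Fin n) K D).symm (d ⊗ₜ 1) = _
    rw [matrixEquivTensor_apply_symm]
    ext i j
    simp [Matrix.algebraMap_matrix_apply, Matrix.one_apply])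

end Matrix

/-- `D ⊗ (C ⊗ S) ≃ D ⊗ S` for a not necessarily commutative algebra `S`. -/
def cancelTensorEquiv (K C D : Type*) [CommRing K] [CommRing C] [Algebra K C] [CommRing D]
    [Algebra C D] [Algebra K D] [IsScalarTower K C D] (S : Type*) [Ring S] [Algebra K S] :
    D ⊗[C] (C ⊗[K] S) ≃ₐ[D] D ⊗[K] S :=
  (Algebra.TensorProduct.assoc K C D D C S).symm.trans
    (Algebra.TensorProduct.congr (Algebra.TensorProduct.rid C D D) AlgEquiv.refl)

/-- If `A` is split by `D`, then over `D` the root algebra of `C ⊗ S` for `A` is the root algebra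
of `S` for a matrix algebra. -/
def splitEquiv {K : Type*} [CommRing K] {C : Type*} [CommRing C] [Algebra K C] {A : Type*} [Ring A]
    [Algebra C A] (F : AzumayaFrame C A) {n : ℕ} (G : AzumayaFrame K (Matrix (Fin n) (Fin n) K))
    {D : Type*} [CommRing D] [Algebra C D] [Algebra K D] [IsScalarTower K C D]
    (e : D ⊗[C] A ≃ₐ[D] Matrix (Fin n) (Fin n) D) (S : Type*) [Ring S] [Algebra K S] :
    D ⊗[C] RootAlgebra C A (C ⊗[K] S) ≃ₐ[D]
      D ⊗[C] (C ⊗[K] RootAlgebra K (Matrix (Fin n) (Fin n) K) S) :=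
  -- Over `D` both sides are the root algebra of `D ⊗ S` for a matrix algebra: base change from `C`
  -- on the left, from `K` on the right.
  (baseChangeEquiv (C ⊗[K] S) D F).trans <|
    (congr (e.trans (tensorMatrixEquiv K D n).symm)
      (cancelTensorEquiv K C D S)).trans <|
    (baseChangeEquiv S D G).symm.trans
      (cancelTensorEquiv K C D _).symm

end RootAlgebra

/-! ### Geometric fibres are matrix algebras. -/

section Fibre

theorem sandwich_mem_twoSidedIdeal {K A : Type*} [CommRing K] [Ring A] [Algebra K A]
    (I : TwoSidedIdeal A) (τ : A ⊗[K] A) {x : A} (hx : x ∈ I) :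
    sandwich (AlgHom.id K A) τ x ∈ I := by
  induction τ with
  | zero => simp
  | tmul p q => simpa using I.mul_mem_right _ _ (I.mul_mem_left _ _ hx)
  | add a b ha hb => simpa using I.add_mem ha hb

/-- Two-sided ideals are stable under the tensors, so an ideal containing `x` contains every scalar
`F.form i x`. Either one of these is a unit, or all of them vanish on the ideal and the ideal is
zero. -/
theorem AzumayaFrame.isSimpleRing {K A : Type*} [Field K] [Ring A] [Algebra K A]
    (F : AzumayaFrame K A) : IsSimpleRing A := by
  have : Nontrivial A := by
    refine ⟨1, 0, fun h => ?_⟩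
    have := congrArg F.unitForm h
    rw [F.unitForm_one, map_zero] at this
    exact one_ne_zero this
  refine ⟨{ exists_pair_ne := ?_, eq_bot_or_eq_top := fun I => ?_ }⟩
  · exact ⟨⊥, ⊤, bot_ne_top⟩
  · by_cases h : ∃ x ∈ I, ∃ i, F.form i x ≠ 0
    · right
      obtain ⟨x, hx, i, hi⟩ := h
      have h₁ := sandwich_mem_twoSidedIdeal I (F.tensor i) hx
      rw [F.sandwich_tensor] at h₁
      have h₂ := I.mul_mem_left (algebraMap K A (F.form i x)⁻¹) _ h₁
      rw [← map_mul, inv_mul_cancel₀ hi, map_one] at h₂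
      exact TwoSidedIdeal.one_mem_iff I |>.1 h₂
    · left
      push Not at h
      refine eq_bot_iff.2 fun x hx => ?_
      rw [← F.sum_form_smul x]
      simp [h x hx]

theorem AzumayaFrame.exists_algEquiv_matrix {C A : Type*} [CommRing C] [Ring A] [Algebra C A]
    [Module.Finite C A] (F : AzumayaFrame C A) {K : Type*} [Field K] [IsAlgClosed K] [Algebra C K]
    {n : ℕ} (hn : Module.finrank K (K ⊗[C] A) = n ^ 2) :
    Nonempty (K ⊗[C] A ≃ₐ[K] Matrix (Fin n) (Fin n) K) := by
  have := (F.baseChange K).isSimpleRing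
  obtain ⟨m, hm, ⟨e⟩⟩ := IsSimpleRing.exists_algEquiv_matrix_of_isAlgClosed K (K ⊗[C] A)
  have h := e.toLinearEquiv.finrank_eq
  rw [hn, Module.finrank_matrix] at h
  have : n = m := by
    simp only [Fintype.card_fin, Module.finrank_self, mul_one, ← sq] at h
    exact Nat.pow_left_injective two_ne_zero h
  subst this
  exact ⟨e⟩

end Fibre

/-! ### Elements with separable characteristic polynomial. -/

section Density

open Polynomial

/-- The resultant is taken with the fixed degrees `n` and `n - 1`, which makes it polynomial in the
entries; in characteristic zero these are the actual degrees. -/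
theorem Matrix.separable_charpoly_iff {K : Type*} [Field K] [CharZero K] {n : ℕ}
    (X : Matrix (Fin n) (Fin n) K) :
    X.charpoly.Separable ↔ resultant X.charpoly (derivative X.charpoly) n (n - 1) ≠ 0 := by
  have h₁ : X.charpoly.natDegree = n := by simp [X.charpoly_natDegree_eq_dim]
  have h₂ : (derivative X.charpoly).natDegree = n - 1 := by
    rw [natDegree_derivative, h₁]
  have h₃ := resultant_eq_zero_iff (f := X.charpoly) (g := derivative X.charpoly)
  rw [h₁, h₂] at h₃
  rw [Polynomial.Separable, Ne, h₃, not_and, not_not]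
  exact ⟨fun h _ => h, fun h => h (Or.inl X.charpoly_monic.ne_zero)⟩

/-- If the image of an additive map to the matrices spans all matrices, then it contains a matrix
with separable characteristic polynomial. -/
theorem exists_separable_charpoly {K : Type*} [Field K] [CharZero K] {n : ℕ} {V : Type*}
    [AddCommGroup V] (φ : V →+ Matrix (Fin n) (Fin n) K)
    (hφ : Submodule.span K (Set.range φ) = ⊤) : ∃ a, (φ a).charpoly.Separable := by
  -- A matrix with the distinct eigenvalues `0, …, n - 1`; it need only lie in the span of the
  -- image.
  let Δ : Matrix (Fin n) (Fin n) K := Matrix.diagonal fun i => ((i : ℕ) : K)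
  have hΔ : Δ.charpoly.Separable := by
    rw [Matrix.charpoly_diagonal]
    exact separable_prod_X_sub_C_iff.2 fun i j h => Fin.ext (Nat.cast_injective h)
  have hmem : Δ ∈ Submodule.span K (Set.range φ) := hφ ▸ Submodule.mem_top
  obtain ⟨m, c, g, hcg⟩ := Submodule.mem_span_set'.1 hmem
  have hg : ∀ i, ∃ a, φ a = g i := fun i => (g i).2
  choose b hb using hg
  let G : Matrix (Fin n) (Fin n) (MvPolynomial (Fin m) K) :=
    ∑ i, (MvPolynomial.X i : MvPolynomial (Fin m) K) •
      (φ (b i)).map (MvPolynomial.C : K →+* MvPolynomial (Fin m) K)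
  let P : MvPolynomial (Fin m) K := resultant G.charpoly (derivative G.charpoly) n (n - 1)
  have hG : ∀ t : Fin m → K, G.map (MvPolynomial.eval t) = ∑ i, t i • φ (b i) := by
    intro t
    ext j k
    simp [G, Matrix.sum_apply]
  have hP : ∀ t : Fin m → K, MvPolynomial.eval t P =
      resultant (∑ i, t i • φ (b i)).charpoly (derivative (∑ i, t i • φ (b i)).charpoly)
        n (n - 1) := by
    intro t
    rw [← hG, Matrix.charpoly_map, derivative_map, resultant_map_map]
  have hP0 : P ≠ 0 := by
    intro h
    have h₁ := hP c
    have h₂ : ∑ i, c i • φ (b i) = Δ := by simpa only [hb] using hcg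
    rw [h, map_zero, h₂] at h₁
    exact (Matrix.separable_charpoly_iff Δ).1 hΔ h₁.symm
  by_contra! hsep
  -- Testing `P` at natural number points suffices, since `ℕ` is infinite in `K`. At such points the
  -- combination of the `φ (b i)` lies in the image of `φ`, although `φ` is only additive.
  apply hP0
  refine MvPolynomial.funext_set (fun _ => Set.range ((↑) : ℕ → K))
    (fun _ => Set.infinite_range_of_injective Nat.cast_injective) fun t ht => ?_
  have ht' : ∀ i, ∃ k : ℕ, (k : K) = t i := fun i => ht i trivial
  choose s hs using ht'
  rw [map_zero, hP]
  have := hsep (∑ i, s i • b i)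
  rw [Matrix.separable_charpoly_iff, not_not] at this
  have h₃ : φ (∑ i, s i • b i) = ∑ i, t i • φ (b i) := by
    simp only [map_sum, map_nsmul, ← hs, Nat.cast_smul_eq_nsmul]
  rwa [h₃] at this

end Density

/-! ### Projections onto eigenlines. -/

section RankOne

open Polynomial
open scoped Matrix

/-- If `X` has separable characteristic polynomial, `l` is an eigenvalue and
`u (x - l) ^ m + v = 1` with `(x - l) ^ m v` vanishing at `X`, then `v (X)` is a projection onto
a line. -/
theorem Matrix.exists_aeval_mulVec_eq {K : Type*} [Field K] {n : ℕ}
    {X : Matrix (Fin n) (Fin n) K} (hX : X.charpoly.Separable) {l : K}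
    (hl : X.charpoly.IsRoot l) {m : ℕ} (hm : m ≠ 0) {u v : K[X]}
    (huv : u * (Polynomial.X - C l) ^ m + v = 1)
    (h0 : aeval X ((Polynomial.X - C l) ^ m * v) = 0) :
    ∃ w : Fin n → K, w ≠ 0 ∧ aeval X v *ᵥ w = w ∧ ∀ x, ∃ c : K, aeval X v *ᵥ x = c • w := by
  let f : Module.End K (Fin n → K) := Matrix.toLin' X
  have hf : f.charpoly = X.charpoly := Matrix.charpoly_toLin' X
  have haev : ∀ p : K[X], aeval f p = Matrix.toLin' (aeval X p) := by
    intro p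
    exact Polynomial.aeval_algHom_apply (Matrix.toLinAlgEquiv' : _ ≃ₐ[K] _).toAlgHom X p
  have hval : Module.End.HasEigenvalue f l := by
    rw [Module.End.hasEigenvalue_iff_isRoot_charpoly, hf]
    exact hl
  obtain ⟨w, hw⟩ := hval.exists_hasEigenvector
  have hv1 : v.eval l = 1 := by
    have := congrArg (Polynomial.eval l) huv
    simpa [hm] using this
  have hfix : aeval X v *ᵥ w = w := by
    rw [← Matrix.toLin'_apply, ← haev, Module.End.aeval_apply_of_hasEigenvector hw, hv1, one_smul]
  refine ⟨w, hw.2, hfix, fun x => ?_⟩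
  -- Separability bounds the algebraic multiplicity of `l` by one, whatever the exponent `m`. Both
  -- `w` and the image of `v (X)` lie in this space.
  have hle : Module.finrank K (f.genEigenspace l m) ≤ 1 :=
    (LinearMap.finrank_genEigenspace_le f l m).trans
      (hf ▸ rootMultiplicity_le_one_of_separable hX l)
  obtain ⟨y, hy⟩ := finrank_le_one_iff.1 hle
  have hsub : aeval f (Polynomial.X - C l) = f - l • 1 := by
    simp [Algebra.algebraMap_eq_smul_one]
  have hwm : w ∈ f.genEigenspace l m := by
    rw [Module.End.mem_genEigenspace_nat, LinearMap.mem_ker, ← Nat.succ_pred_eq_of_ne_zero hm,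
      pow_succ, Module.End.mul_apply]
    have : (f - l • 1) w = 0 := by simp [hw.apply_eq_smul]
    rw [this, map_zero]
  have hxm : aeval X v *ᵥ x ∈ f.genEigenspace l m := by
    rw [Module.End.mem_genEigenspace_nat, LinearMap.mem_ker, ← hsub, ← map_pow,
      ← Matrix.toLin'_apply, ← haev, ← Module.End.mul_apply, ← map_mul, haev, h0]
    simp
  obtain ⟨a, ha⟩ := hy ⟨w, hwm⟩
  obtain ⟨b, hb⟩ := hy ⟨_, hxm⟩
  have ha' : a • (y : Fin n → K) = w := congrArg Subtype.val ha
  have hb' : b • (y : Fin n → K) = aeval X v *ᵥ x := congrArg Subtype.val hb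
  have ha0 : a ≠ 0 := by
    rintro rfl
    exact hw.2 (by rw [← ha', zero_smul])
  exact ⟨b * a⁻¹, by rw [← ha', ← hb', smul_smul, inv_mul_cancel_right₀ ha0]⟩

/-- For a projection `E` onto a line, the space of matrices `Y E` has dimension `n`. -/
theorem Matrix.finrank_range_mulRight {K : Type*} [Field K] {n : ℕ}
    {E : Matrix (Fin n) (Fin n) K} {w : Fin n → K} (hw : w ≠ 0) (hE : E *ᵥ w = w)
    (h : ∀ x, ∃ c : K, E *ᵥ x = c • w) :
    Module.finrank K (LinearMap.range (LinearMap.mulRight K E)) = n := by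
  -- A matrix `Y E` is determined by its value at `w`, which is arbitrary.
  let f : LinearMap.range (LinearMap.mulRight K E) →ₗ[K] (Fin n → K) :=
    { toFun := fun Y => (Y : Matrix (Fin n) (Fin n) K) *ᵥ w
      map_add' := fun Y Z => by simp [Matrix.add_mulVec]
      map_smul' := fun c Y => by simp [Matrix.smul_mulVec] }
  have hf : Function.Bijective f := by
    constructor
    · rw [injective_iff_map_eq_zero]
      rintro ⟨_, Y, rfl⟩ hY
      have hY' : Y *ᵥ w = 0 := by
        have : (Y * E) *ᵥ w = 0 := hY
        rwa [← Matrix.mulVec_mulVec, hE] at this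
      apply Subtype.ext
      change Y * E = 0
      apply Matrix.toLin'.injective
      ext1 x
      obtain ⟨c, hc⟩ := h (Pi.single x 1)
      ext1
      simp only [LinearMap.comp_apply, LinearMap.single_apply, Matrix.toLin'_apply,
        ← Matrix.mulVec_mulVec, hc, Matrix.mulVec_smul, hY']
      simp
      rfl
    · intro z
      obtain ⟨i, hi⟩ := Function.ne_iff.1 hw
      refine ⟨⟨Matrix.vecMulVec z (Pi.single i (w i)⁻¹) * E, _, rfl⟩, ?_⟩
      change (Matrix.vecMulVec z (Pi.single i (w i)⁻¹) * E) *ᵥ w = z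
      rw [← Matrix.mulVec_mulVec, hE, Matrix.vecMulVec_mulVec, single_dotProduct]
      simp [inv_mul_cancel₀ hi]
  rw [(LinearEquiv.ofBijective f hf).finrank_eq]
  simp

end RankOne

/-! ### Lifting coprime factorizations to étale algebras. -/

section EtaleFactorization

open Polynomial

/-- The algebra classifying coprime monic factorizations of `f` with given degrees is étale over
`C`; the factorization over `K` is one of its `K`-points `γ`, and the universal factors specialize
to it. -/
theorem exists_etale_factorization {C : Type u} [CommRing C] {K : Type v} [Field K] [Algebra C K]
    {f : C[X]} (hf : f.Monic) {p q : K[X]} (hp : p.Monic) (hq : q.Monic)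
    (h : f.map (algebraMap C K) = p * q) (hpq : IsCoprime p q) :
    ∃ (D : Type u) (_ : CommRing D) (_ : Algebra C D) (_ : Algebra.Etale C D) (γ : D →ₐ[C] K)
      (P Q : D[X]), P * Q = f.map (algebraMap C D) ∧ IsCoprime P Q ∧
        P.map γ.toRingHom = p ∧ Q.map γ.toRingHom = q := by
  have hn : f.natDegree = p.natDegree + q.natDegree := by
    rw [← hp.natDegree_mul hq, ← h, hf.natDegree_map]
  let f' : MonicDegreeEq C f.natDegree := .mk f hf rfl
  let pq : { q' : MonicDegreeEq K p.natDegree × MonicDegreeEq K q.natDegree //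
      q'.1.1 * q'.2.1 = f'.1.map (algebraMap C K) ∧ IsCoprime q'.1.1 q'.2.1 } :=
    ⟨(.mk p hp rfl, .mk q hq rfl), h.symm, hpq⟩
  let E := UniversalCoprimeFactorizationRing.homEquiv K p.natDegree q.natDegree hn f'
  let γ := E.symm pq
  have hγ : E γ = pq := E.apply_symm_apply pq
  let U := UniversalCoprimeFactorizationRing.homEquiv
    (UniversalCoprimeFactorizationRing p.natDegree q.natDegree hn f') _ _ hn f' (AlgHom.id C _)
  refine ⟨UniversalCoprimeFactorizationRing p.natDegree q.natDegree hn f', inferInstance,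
    inferInstance, inferInstance, γ, U.1.1.1, U.1.2.1, U.2.1, U.2.2, ?_, ?_⟩
  · have h₁ := congrArg (fun x => x.1.1.1) hγ
    refine Eq.trans ?_ h₁
    exact congrArg Subtype.val
      (UniversalCoprimeFactorizationRing.homEquiv_comp_fst _ _ _ hn f' (AlgHom.id C _) γ).symm
  · have h₁ := congrArg (fun x => x.1.2.1) hγ
    refine Eq.trans ?_ h₁
    exact congrArg Subtype.val
      (UniversalCoprimeFactorizationRing.homEquiv_comp_snd _ _ _ hn f' (AlgHom.id C _) γ).symm

end EtaleFactorization

/-! ### Ranks of fibres and spanning near a prime. -/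

section Rank

open Module

theorem finrank_tensor_of_rankAtStalk {C : Type*} [CommRing C] {A : Type*} [AddCommGroup A]
    [Module C A] [Module.Finite C A] [Module.Projective C A] {r : ℕ}
    (h : ∀ p : PrimeSpectrum C, rankAtStalk (R := C) A p = r) (L : Type*) [Field L] [Algebra C L] :
    finrank L (L ⊗[C] A) = r := by
  have h₁ := rankAtStalk_baseChange (R := C) (M := A) (S := L) ⊥
  rw [h, rankAtStalk_eq_finrank_of_free] at h₁
  exact_mod_cast h₁

/-- On the fibre at `q` the homomorphism is injective between spaces of dimension `n ^ 2`, hence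
surjective. So the finitely generated cokernel of the span vanishes at `q` and is killed by some `g`
outside `q`. -/
theorem exists_smul_mem_span_range {C : Type*} [CommRing C] {A : Type*} [Ring A] [Algebra C A]
    [Module.Finite C A] [Module.Projective C A] (F : AzumayaFrame C A) {n : ℕ} (hn : n ≠ 0)
    (h : ∀ p : PrimeSpectrum C, rankAtStalk (R := C) A p = n ^ 2)
    {D : Type*} [CommRing D] [Algebra C D] (φ : A →ₐ[C] Matrix (Fin n) (Fin n) D)
    (q : PrimeSpectrum D) :
    ∃ g : D, g ∉ q.asIdeal ∧ ∀ M, g • M ∈ Submodule.span D (Set.range φ) := by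
  let N := Submodule.span D (Set.range φ)
  let κ := q.asIdeal.ResidueField
  have : Nontrivial D := q.nontrivial
  let T := κ ⊗[D] Matrix (Fin n) (Fin n) D
  let Φ : κ ⊗[C] A →ₐ[κ] T :=
    Algebra.TensorProduct.lift (Algebra.ofId κ T)
      (((Algebra.TensorProduct.includeRight : Matrix (Fin n) (Fin n) D →ₐ[D] T).restrictScalars
        C).comp φ) (fun k x => Algebra.commutes k _)
  have hT : finrank κ T = n ^ 2 := by
    rw [finrank_baseChange, finrank_matrix]
    simp [sq]
  have hΦ : Function.Surjective Φ := by
    have hinj : Function.Injective Φ := by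
      apply (F.baseChange κ).injective_of_algebraMap_injective Φ
      have : Nontrivial T := by
        apply Module.nontrivial_of_finrank_pos (R := κ)
        rw [hT]
        positivity
      exact FaithfulSMul.algebraMap_injective κ T
    exact (LinearMap.injective_iff_surjective_of_finrank_eq_finrank (f := Φ.toLinearMap)
      (by rw [hT, finrank_tensor_of_rankAtStalk h])).1 hinj
  have hsub : Subsingleton (κ ⊗[D] (Matrix (Fin n) (Fin n) D ⧸ N)) := by
    have hsurj : Function.Surjective (N.mkQ.baseChange κ) :=
      LinearMap.lTensor_surjective κ N.mkQ_surjective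
    refine subsingleton_of_forall_eq 0 fun y => ?_
    obtain ⟨t, rfl⟩ := hsurj y
    obtain ⟨s, rfl⟩ := hΦ t
    induction s with
    | zero => simp
    | add a b ha hb => simp only [map_add, ha, hb, add_zero]
    | tmul k a =>
      have h₁ : Φ (k ⊗ₜ a) = k ⊗ₜ φ a := by
        refine (Algebra.TensorProduct.lift_tmul _ _ _ _ _).trans ?_
        exact (Algebra.TensorProduct.tmul_mul_tmul k 1 1 (φ a)).trans (by rw [mul_one, one_mul])
      have h₂ : N.mkQ (φ a) = 0 := by
        rw [Submodule.mkQ_apply, Submodule.Quotient.mk_eq_zero]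
        exact Submodule.subset_span ⟨a, rfl⟩
      rw [h₁, LinearMap.baseChange_tmul, h₂, TensorProduct.tmul_zero]
  have hq : q ∉ Module.support D (Matrix (Fin n) (Fin n) D ⧸ N) := by
    rw [Module.mem_support_iff_nontrivial_residueField_tensorProduct,
      not_nontrivial_iff_subsingleton]
    exact hsub
  rw [Module.mem_support_iff_of_finite, SetLike.not_le_iff_exists] at hq
  obtain ⟨g, hg, hgq⟩ := hq
  refine ⟨g, hgq, fun M => ?_⟩
  have := Module.mem_annihilator.1 hg (N.mkQ M)
  rwa [← map_smul, Submodule.mkQ_apply, Submodule.Quotient.mk_eq_zero] at this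

end Rank

/-! ### From a projective module to a matrix representation. -/

section Local

open Module

/-- An action of `D ⊗ A` on a finite projective `D`-module whose fibre at a point has rank `n`
gives a homomorphism from `A` to the matrices of degree `n` over a localization of `D`. -/
theorem exists_etale_hom_matrix {C : Type u} [CommRing C] {A : Type v} [Ring A] [Algebra C A]
    {K : Type w} [Field K] [Algebra C K] {n : ℕ} {D : Type u} [CommRing D] [Algebra C D]
    [Algebra.Etale C D] (γ : D →ₐ[C] K) {P : Type x} [AddCommGroup P] [Module D P]
    [Module.Finite D P] [Module.Projective D P] (Φ : D ⊗[C] A →ₐ[D] Module.End D P)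
    (hP : letI := γ.toAlgebra; finrank K (K ⊗[D] P) = n) :
    ∃ (D₁ : Type u) (_ : CommRing D₁) (_ : Algebra C D₁) (_ : Algebra.Etale C D₁)
      (_ : D₁ →ₐ[C] K), Nonempty (A →ₐ[C] Matrix (Fin n) (Fin n) D₁) := by
  let q : Ideal D := RingHom.ker γ.toRingHom
  have : q.IsPrime := RingHom.ker_isPrime _
  have : FinitePresentation D P := finitePresentation_of_projective D P
  have : Module.Free (Localization.AtPrime q) (LocalizedModule q.primeCompl P) :=
    Module.free_of_flat_of_isLocalRing
  -- Freeness at the kernel of `γ` spreads to a basic open set `g ≠ 0` containing it, and there `γ`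
  -- still extends.
  obtain ⟨g, hg, hfree, -⟩ := FinitePresentation.exists_free_localizedModule_powers q.primeCompl
    (LocalizedModule.mkLinearMap q.primeCompl P) (Localization.AtPrime q)
  let D₁ := Localization.Away g
  have hγg : IsUnit (γ g) := isUnit_iff_ne_zero.2 hg
  let γ₁ : D₁ →ₐ[C] K := IsLocalization.Away.liftAlgHom (f := γ) g hγg
  have hγ₁ : ∀ d, γ₁ (algebraMap D D₁ d) = γ d := fun d => IsLocalization.Away.lift_eq g hγg d
  have : Module.Free D₁ (D₁ ⊗[D] P) :=
    Module.Free.of_equiv (LocalizedModule.equivTensorProduct (.powers g) P)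
  let _ : Algebra D K := γ.toAlgebra
  let _ : Algebra D₁ K := γ₁.toAlgebra
  have : IsScalarTower D D₁ K := .of_algebraMap_eq fun d => (hγ₁ d).symm
  have : Nontrivial D₁ := γ₁.toRingHom.domain_nontrivial
  have hn : finrank D₁ (D₁ ⊗[D] P) = n := by
    rw [← finrank_baseChange (R := K) (S := D₁), ← hP]
    exact (TensorProduct.AlgebraTensorModule.cancelBaseChange D D₁ K K P).finrank_eq
  let b := Module.finBasisOfFinrankEq D₁ (D₁ ⊗[D] P) hn
  let Ψ : D ⊗[C] A →ₐ[D] Matrix (Fin n) (Fin n) D₁ :=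
    ((algEquivMatrix b).toAlgHom.restrictScalars D).comp ((Module.End.baseChangeHom D D₁ P).comp Φ)
  exact ⟨D₁, inferInstance, inferInstance, inferInstance, γ₁,
    ⟨(Ψ.restrictScalars C).comp Algebra.TensorProduct.includeRight⟩⟩

/-- The left multiplication action of an algebra on a left ideal generated by one element. -/
def mulLeftRange {D X : Type*} [CommRing D] [Ring X] [Algebra D X] (e : X) :
    X →ₐ[D] Module.End D (LinearMap.range (LinearMap.mulRight D e)) :=
  AlgHom.ofLinearMap
    { toFun := fun x => (LinearMap.mulLeft D x).restrict (by
        rintro _ ⟨y, rfl⟩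
        exact ⟨x * y, by simp [mul_assoc]⟩)
      map_add' := fun x y => by ext; simp [add_mul]
      map_smul' := fun c x => by ext; simp }
    (by ext; simp) (fun x y => by ext; simp)

theorem projective_range_mulRight {D X : Type*} [CommRing D] [Ring X] [Algebra D X]
    [Module.Projective D X] {e : X} (he : IsIdempotentElem e) :
    Module.Projective D (LinearMap.range (LinearMap.mulRight D e)) := by
  refine Module.Projective.of_split (LinearMap.range (LinearMap.mulRight D e)).subtype
    (LinearMap.mulRight D e).rangeRestrict ?_
  ext ⟨_, x, rfl⟩
  simp [mul_assoc, he.eq]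

/-- The dimension of the fibre of a left ideal generated by an idempotent. -/
theorem finrank_tensor_range_mulRight {D X K : Type*} [CommRing D] [Ring X] [Algebra D X]
    [Field K] [Algebra D K] {e : X} (he : IsIdempotentElem e) {n : ℕ}
    (Θ : K ⊗[D] X ≃ₐ[K] Matrix (Fin n) (Fin n) K) :
    finrank K (K ⊗[D] LinearMap.range (LinearMap.mulRight D e)) =
      finrank K (LinearMap.range (LinearMap.mulRight K (Θ (1 ⊗ₜ e)))) := by
  let P := LinearMap.range (LinearMap.mulRight D e)
  let ι : K ⊗[D] P →ₗ[K] K ⊗[D] X := P.subtype.baseChange K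
  let ρ : K ⊗[D] X →ₗ[K] K ⊗[D] P := (LinearMap.mulRight D e).rangeRestrict.baseChange K
  have hρι : ρ ∘ₗ ι = LinearMap.id := by
    have : (LinearMap.mulRight D e).rangeRestrict ∘ₗ P.subtype = LinearMap.id := by
      ext ⟨_, x, rfl⟩
      simp [mul_assoc, he.eq]
    rw [← LinearMap.baseChange_comp, this, LinearMap.baseChange_id]
  have hιρ : ∀ x, ι (ρ x) = x * (1 ⊗ₜ e) := by
    intro x
    induction x with
    | zero => simp
    | add a b ha hb => simp only [map_add, add_mul, ha, hb]
    | tmul k x => simp [ι, ρ, P]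
  -- Since `e` is idempotent, the left ideal is a direct summand and stays embedded after tensoring
  -- with `K`.
  let κ : K ⊗[D] P →ₗ[K] Matrix (Fin n) (Fin n) K := Θ.toLinearMap ∘ₗ ι
  have hκ : Function.Injective κ :=
    Θ.injective.comp (Function.LeftInverse.injective (g := ρ) (LinearMap.congr_fun hρι))
  have hrange : LinearMap.range κ = LinearMap.range (LinearMap.mulRight K (Θ (1 ⊗ₜ e))) := by
    apply le_antisymm
    · rintro _ ⟨y, rfl⟩
      refine ⟨κ y, ?_⟩
      have : ι y = ι (ρ (ι y)) := congrArg ι (LinearMap.congr_fun hρι y).symm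
      rw [LinearMap.mulRight_apply]
      change Θ (ι y) * _ = Θ (ι y)
      conv_rhs => rw [this, hιρ, map_mul]
    · rintro _ ⟨y, rfl⟩
      obtain ⟨x, rfl⟩ := Θ.surjective y
      exact ⟨ρ x, by simp [κ, hιρ]⟩
  rw [← hrange, LinearMap.finrank_range_of_inj hκ]

end Local

/-! ### Étale neighbourhoods in which the algebra splits. -/

section Local

open Module Polynomial
open scoped Matrix

theorem span_range_eq_top_of_algEquiv {C A K X : Type*} [CommRing C] [Ring A] [Algebra C A]
    [CommRing K] [Algebra C K] [Ring X] [Algebra K X] (e : K ⊗[C] A ≃ₐ[K] X) :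
    Submodule.span K (Set.range fun a => e (1 ⊗ₜ a)) = ⊤ := by
  rw [eq_top_iff]
  rintro x -
  obtain ⟨y, rfl⟩ := e.surjective x
  induction y with
  | zero => simp
  | add a b ha hb => simpa using Submodule.add_mem _ ha hb
  | tmul k a =>
    have : k ⊗ₜ[C] a = k • (1 ⊗ₜ a) := by simp [TensorProduct.smul_tmul']
    rw [this, map_smul]
    exact Submodule.smul_mem _ _ (Submodule.subset_span ⟨a, rfl⟩)

theorem Matrix.isRoot_of_isRoot_charpoly {K : Type*} [Field K] {n : ℕ}
    {X : Matrix (Fin n) (Fin n) K} {l : K} (hl : X.charpoly.IsRoot l) {f : K[X]}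
    (hf : aeval X f = 0) : f.IsRoot l := by
  have hval : Module.End.HasEigenvalue (Matrix.toLin' X) l := by
    rw [Module.End.hasEigenvalue_iff_isRoot_charpoly, Matrix.charpoly_toLin']
    exact hl
  obtain ⟨w, hw⟩ := hval.exists_hasEigenvector
  have h₁ := Module.End.aeval_apply_of_hasEigenvector (p := f) hw
  have h₂ : aeval (Matrix.toLin' X) f = Matrix.toLin' (aeval X f) :=
    Polynomial.aeval_algHom_apply (Matrix.toLinAlgEquiv' : _ ≃ₐ[K] _).toAlgHom X f
  rw [h₂, hf, map_zero, LinearMap.zero_apply] at h₁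
  exact (smul_eq_zero.1 h₁.symm).resolve_right hw.2

/-- An idempotent with image a projection onto a line is cut out by a coprime factorization, which
exists over `K` and lifts to an étale algebra. -/
theorem exists_etale_hom_matrix_of_algEquiv {C : Type u} [CommRing C] {A : Type v} [Ring A]
    [Algebra C A] [Module.Finite C A] [Module.Projective C A] {K : Type w} [Field K]
    [IsAlgClosed K] [CharZero K] [Algebra C K] {n : ℕ} (hn : n ≠ 0)
    (e : K ⊗[C] A ≃ₐ[K] Matrix (Fin n) (Fin n) K) :
    ∃ (D : Type u) (_ : CommRing D) (_ : Algebra C D) (_ : Algebra.Etale C D)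
      (_ : D →ₐ[C] K), Nonempty (A →ₐ[C] Matrix (Fin n) (Fin n) D) := by
  let φ : A →+ Matrix (Fin n) (Fin n) K :=
    e.toLinearMap.toAddMonoidHom.comp (TensorProduct.mk C K A 1).toAddMonoidHom
  obtain ⟨a, ha⟩ := exists_separable_charpoly φ (span_range_eq_top_of_algEquiv e)
  set X : Matrix (Fin n) (Fin n) K := φ a with hX
  obtain ⟨l, hl⟩ := IsAlgClosed.exists_root X.charpoly (by
    rw [Matrix.charpoly_degree_eq_dim]
    simpa using hn)
  -- Any monic annihilator of `a` will do: it need not be the characteristic polynomial, so `l` may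
  -- be a root of multiplicity `m > 1`.
  obtain ⟨f, hf, hfa⟩ := IsIntegral.of_finite C a
  rw [← aeval_def] at hfa
  let f' := f.map (algebraMap C K)
  have hf' : f'.Monic := hf.map _
  have hfX : aeval X f' = 0 := by
    have h₁ : aeval ((1 : K) ⊗ₜ[C] a) f' = 0 := by
      rw [aeval_map_algebraMap]
      have := aeval_algHom_apply (Algebra.TensorProduct.includeRight : A →ₐ[C] K ⊗[C] A) a f
      rwa [hfa, map_zero] at this
    have h₂ := aeval_algHom_apply e.toAlgHom ((1 : K) ⊗ₜ[C] a) f'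
    rwa [h₁, map_zero] at h₂
  have hroot := Matrix.isRoot_of_isRoot_charpoly hl hfX
  obtain ⟨h, hh, hdvd⟩ := exists_eq_pow_rootMultiplicity_mul_and_not_dvd f' hf'.ne_zero l
  set m := f'.rootMultiplicity l
  have hm : m ≠ 0 := ((rootMultiplicity_pos hf'.ne_zero).2 hroot).ne'
  have hpm : ((Polynomial.X - Polynomial.C l) ^ m).Monic := (monic_X_sub_C l).pow m
  have hhm : h.Monic := hpm.of_mul_monic_left (hh ▸ hf')
  have hcop : IsCoprime ((Polynomial.X - Polynomial.C l) ^ m) h :=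
    ((irreducible_X_sub_C l).coprime_iff_not_dvd.2 hdvd).pow_left
  obtain ⟨D, _, _, _, γ, P, Q, hPQ, ⟨s, t, hst⟩, hP, hQ⟩ :=
    exists_etale_factorization hf hpm hhm hh hcop
  let _ : Algebra D K := γ.toAlgebra
  have : IsScalarTower C D K := .of_algebraMap_eq fun c => (γ.commutes c).symm
  -- From `s P + t Q = 1`, the element `r (1 - r)` is a multiple of `P Q`, which kills `x`; hence `r
  -- (x)` is idempotent.
  let r : D[X] := t * Q
  let x : D ⊗[C] A := 1 ⊗ₜ a
  have hx : aeval x (P * Q) = 0 := by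
    rw [hPQ, aeval_map_algebraMap]
    have := aeval_algHom_apply (Algebra.TensorProduct.includeRight : A →ₐ[C] D ⊗[C] A) a f
    rwa [hfa, map_zero] at this
  let ε := aeval x r
  have hε : IsIdempotentElem ε := by
    have : r * r = r - s * t * (P * Q) := by linear_combination (t * Q) * hst
    rw [IsIdempotentElem, ← map_mul, this, map_sub, map_mul _ (s * t), hx, mul_zero, sub_zero]
  let Θ : K ⊗[D] (D ⊗[C] A) ≃ₐ[K] Matrix (Fin n) (Fin n) K :=
    (RootAlgebra.cancelTensorEquiv C D K A).trans e
  have hΘ : Θ (1 ⊗ₜ ε) = aeval X (r.map (algebraMap D K)) := by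
    have h₁ : Θ (1 ⊗ₜ x) = X := by simp [Θ, x, RootAlgebra.cancelTensorEquiv, hX, φ]
    have h₂ := aeval_algHom_apply ((Θ.toAlgHom.restrictScalars D).comp
      (Algebra.TensorProduct.includeRight : D ⊗[C] A →ₐ[D] K ⊗[D] (D ⊗[C] A))) x r
    rw [aeval_map_algebraMap, ← h₁]
    exact h₂.symm
  have huv : s.map (algebraMap D K) * (Polynomial.X - Polynomial.C l) ^ m + r.map (algebraMap D K) = 1 := by
    have := congrArg (Polynomial.map (algebraMap D K)) hst
    have hP' : P.map (algebraMap D K) = (Polynomial.X - Polynomial.C l) ^ m := hP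
    rw [← hP']
    simpa [r] using this
  -- Over `K`, `P` is `(X - l) ^ m` and `Q` is `h`, so this product is a multiple of `f'`.
  have h0 : aeval X ((Polynomial.X - Polynomial.C l) ^ m * r.map (algebraMap D K)) = 0 := by
    have hQ' : Q.map (algebraMap D K) = h := hQ
    have : (Polynomial.X - Polynomial.C l) ^ m * r.map (algebraMap D K) =
        t.map (algebraMap D K) * f' := by
      rw [hh, Polynomial.map_mul, hQ']
      ring
    rw [this, map_mul, hfX, mul_zero]
  obtain ⟨w, hw, hfix, hline⟩ := Matrix.exists_aeval_mulVec_eq ha hl hm huv h0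
  have : Module.Projective D (LinearMap.range (LinearMap.mulRight D ε)) :=
    projective_range_mulRight hε
  have hfin := finrank_tensor_range_mulRight hε Θ
  rw [hΘ, Matrix.finrank_range_mulRight hw hfix hline] at hfin
  exact exists_etale_hom_matrix γ (mulLeftRange ε) hfin

/-- An algebra homomorphism to matrices over an étale algebra, localized such that its image spans
all matrices. -/
theorem exists_etale_span_eq_top {C : Type u} [CommRing C] [Algebra ℚ C] {A : Type v} [Ring A]
    [Algebra C A] [Module.Finite C A] [Module.Projective C A] (F : AzumayaFrame C A) {n : ℕ}
    (hn : n ≠ 0) (hA : ∀ p : PrimeSpectrum C, rankAtStalk (R := C) A p = n ^ 2)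
    (p : PrimeSpectrum C) :
    ∃ (D : Type u) (_ : CommRing D) (_ : Algebra C D) (_ : Algebra.Etale C D)
      (φ : A →ₐ[C] Matrix (Fin n) (Fin n) D), p ∈ Set.range (PrimeSpectrum.comap (algebraMap C D)) ∧
        Submodule.span D (Set.range φ) = ⊤ := by
  let K := AlgebraicClosure p.asIdeal.ResidueField
  have : CharZero K := by
    have : CharZero p.asIdeal.ResidueField :=
      let _ : Algebra ℚ p.asIdeal.ResidueField := Algebra.compHom _ (algebraMap ℚ C)
      algebraRat.charZero _
    infer_instance
  obtain ⟨e⟩ := F.exists_algEquiv_matrix (finrank_tensor_of_rankAtStalk hA K)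
  obtain ⟨D, _, _, _, γ, ⟨φ⟩⟩ := exists_etale_hom_matrix_of_algEquiv hn e
  let q : PrimeSpectrum D := ⟨RingHom.ker γ.toRingHom, RingHom.ker_isPrime _⟩
  -- Inverting `g` makes the image span, and keeps the `K`-point, hence `p` in the image of the
  -- spectrum, because `g` is outside the kernel of `γ`.
  obtain ⟨g, hg, hgM⟩ := exists_smul_mem_span_range F hn hA φ q
  let D₁ := Localization.Away g
  have hγg : IsUnit (γ g) := isUnit_iff_ne_zero.2 hg
  let γ₁ : D₁ →ₐ[C] K := IsLocalization.Away.liftAlgHom (f := γ) g hγg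
  let π : Matrix (Fin n) (Fin n) D →ₐ[D] Matrix (Fin n) (Fin n) D₁ :=
    (Algebra.ofId D D₁).mapMatrix
  refine ⟨D₁, inferInstance, inferInstance, inferInstance, (π.restrictScalars C).comp φ, ?_, ?_⟩
  · refine ⟨⟨RingHom.ker γ₁.toRingHom, RingHom.ker_isPrime _⟩, ?_⟩
    ext c
    have : γ₁ (algebraMap C D₁ c) = algebraMap p.asIdeal.ResidueField K
        (algebraMap C p.asIdeal.ResidueField c) := γ₁.commutes c
    change γ₁ (algebraMap C D₁ c) = 0 ↔ c ∈ p.asIdeal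
    rw [this, map_eq_zero, Ideal.algebraMap_residueField_eq_zero]
  · have hu : IsUnit (algebraMap D D₁ g) := IsLocalization.Away.algebraMap_isUnit g
    have key : ∀ M : Matrix (Fin n) (Fin n) D,
        π M ∈ Submodule.span D₁ (Set.range ((π.restrictScalars C).comp φ)) := by
      intro M
      have h₁ : ∀ N ∈ Submodule.span D (Set.range φ),
          π N ∈ Submodule.span D₁ (Set.range ((π.restrictScalars C).comp φ)) := by
        intro N hN
        induction hN using Submodule.span_induction with
        | mem x hx =>
          obtain ⟨a, rfl⟩ := hx
          exact Submodule.subset_span ⟨a, rfl⟩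
        | zero => simp
        | add x y _ _ hx hy => simpa using Submodule.add_mem _ hx hy
        | smul d x _ hx =>
          rw [map_smul, ← algebraMap_smul D₁ d]
          exact Submodule.smul_mem _ _ hx
      have h₂ := h₁ _ (hgM M)
      rw [map_smul, ← algebraMap_smul D₁ g] at h₂
      exact (Submodule.smul_mem_iff_of_isUnit _ hu).1 h₂
    rw [eq_top_iff]
    rintro M -
    rw [Matrix.matrix_eq_sum_single M]
    refine Submodule.sum_mem _ fun i _ => Submodule.sum_mem _ fun j _ => ?_
    have : Matrix.single i j (M i j) = M i j • π (Matrix.single i j 1) := by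
      simp [π, AlgHom.mapMatrix_apply, Matrix.map_single]
    rw [this]
    exact Submodule.smul_mem _ _ (key _)

end Local

/-! ### Splitting by a faithfully flat étale algebra. -/

section Splitting

/-- Spanning gives surjectivity; injectivity is automatic for an Azumaya source, as scalars embed
into matrices of positive size. -/
theorem nonempty_algEquiv_matrix_of_span_eq_top {C A : Type*} [CommRing C] [Ring A] [Algebra C A]
    (F : AzumayaFrame C A) {n : ℕ} (hn : n ≠ 0) {D : Type*} [CommRing D] [Algebra C D]
    (φ : A →ₐ[C] Matrix (Fin n) (Fin n) D) (hφ : Submodule.span D (Set.range φ) = ⊤) :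
    Nonempty (D ⊗[C] A ≃ₐ[D] Matrix (Fin n) (Fin n) D) := by
  let Φ : D ⊗[C] A →ₐ[D] Matrix (Fin n) (Fin n) D :=
    Algebra.TensorProduct.lift (Algebra.ofId D _) φ (fun d x => Algebra.commutes d _)
  have hΦ : ∀ a, Φ (1 ⊗ₜ a) = φ a := fun a =>
    (Algebra.TensorProduct.lift_tmul _ _ _ _ _).trans (by rw [map_one, one_mul])
  refine ⟨AlgEquiv.ofBijective Φ ⟨?_, ?_⟩⟩
  · apply (F.baseChange D).injective_of_algebraMap_injective
    intro d d' h
    have := congrFun (congrFun h ⟨0, Nat.pos_of_ne_zero hn⟩) ⟨0, Nat.pos_of_ne_zero hn⟩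
    simpa [Matrix.algebraMap_matrix_apply] using this
  · have : LinearMap.range Φ.toLinearMap = ⊤ := by
      rw [eq_top_iff, ← hφ, Submodule.span_le]
      rintro _ ⟨a, rfl⟩
      exact ⟨1 ⊗ₜ a, hΦ a⟩
    exact LinearMap.range_eq_top.1 this

section Pi

variable {C A : Type*} [CommRing C] [Ring A] [Algebra C A] {n : ℕ} {ι : Type*}
  {D : ι → Type*} [∀ k, CommRing (D k)] [∀ k, Algebra C (D k)]

/-- A family of homomorphisms to matrices as a homomorphism to matrices over the product. -/
def matrixPiHom (φ : ∀ k, A →ₐ[C] Matrix (Fin n) (Fin n) (D k)) :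
    A →ₐ[C] Matrix (Fin n) (Fin n) (∀ k, D k) :=
  AlgHom.ofLinearMap
    { toFun := fun a => Matrix.of fun i j k => φ k a i j
      map_add' := fun a b => by ext; simp
      map_smul' := fun c a => by ext; simp }
    (by
      ext i j k
      by_cases h : i = j <;> simp [Matrix.one_apply, h])
    (fun a b => by
      ext i j k
      simp [Matrix.mul_apply])

theorem matrixPiHom_apply (φ : ∀ k, A →ₐ[C] Matrix (Fin n) (Fin n) (D k)) (a : A)
    (i j : Fin n) (k : ι) : matrixPiHom φ a i j k = φ k a i j := rfl

theorem span_range_matrixPiHom [Finite ι] (φ : ∀ k, A →ₐ[C] Matrix (Fin n) (Fin n) (D k))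
    (h : ∀ k, Submodule.span (D k) (Set.range (φ k)) = ⊤) :
    Submodule.span (∀ k, D k) (Set.range (matrixPiHom φ)) = ⊤ := by
  classical
  have := Fintype.ofFinite ι
  -- Extension by zero from one factor; on the image of `φ k` it is multiplication of `matrixPiHom φ
  -- a` by the idempotent of that factor.
  let σ (k : ι) (N : Matrix (Fin n) (Fin n) (D k)) : Matrix (Fin n) (Fin n) (∀ k, D k) :=
    Matrix.of fun i j => Pi.single k (N i j)
  have key : ∀ k N, σ k N ∈ Submodule.span (∀ k, D k) (Set.range (matrixPiHom φ)) := by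
    intro k N
    have hN : N ∈ Submodule.span (D k) (Set.range (φ k)) := h k ▸ Submodule.mem_top
    induction hN using Submodule.span_induction with
    | mem x hx =>
      obtain ⟨a, rfl⟩ := hx
      have : σ k (φ k a) = (Pi.single k 1 : ∀ k, D k) • matrixPiHom φ a := by
        ext i j l
        by_cases hl : l = k
        · subst hl; simp [σ, matrixPiHom_apply]
        · simp [σ, hl]
      rw [this]
      exact Submodule.smul_mem _ _ (Submodule.subset_span ⟨a, rfl⟩)
    | zero =>
      have : σ k 0 = 0 := by ext i j l; simp [σ]
      rw [this]
      exact Submodule.zero_mem _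
    | add x y _ _ hx hy =>
      have : σ k (x + y) = σ k x + σ k y := by
        ext i j l
        simp [σ, Pi.single_add]
      rw [this]
      exact Submodule.add_mem _ hx hy
    | smul d x _ hx =>
      have : σ k (d • x) = (Pi.single k d : ∀ k, D k) • σ k x := by
        ext i j l
        by_cases hl : l = k
        · subst hl; simp [σ]
        · simp [σ, hl]
      rw [this]
      exact Submodule.smul_mem _ _ hx
  rw [eq_top_iff]
  rintro M -
  have : M = ∑ k, σ k (M.map fun x => x k) := by
    ext i j l
    simp [σ, Matrix.sum_apply]
  rw [this]
  exact Submodule.sum_mem _ fun k _ => key k _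

end Pi

open Module in
/-- An Azumaya algebra of constant degree over a `ℚ`-algebra is split by a faithfully flat étale
algebra. -/
theorem exists_etale_algEquiv_matrix {C : Type u} [CommRing C] [Algebra ℚ C] {A : Type v} [Ring A]
    [Algebra C A] [Module.Finite C A] [Module.Projective C A] (F : AzumayaFrame C A) {n : ℕ}
    (hn : n ≠ 0) (hA : ∀ p : PrimeSpectrum C, rankAtStalk (R := C) A p = n ^ 2) :
    ∃ (D : Type u) (_ : CommRing D) (_ : Algebra C D), Algebra.Etale C D ∧
      Module.FaithfullyFlat C D ∧ Nonempty (D ⊗[C] A ≃ₐ[D] Matrix (Fin n) (Fin n) D) := by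
  choose D _ _ _ φ hp hφ using exists_etale_span_eq_top F hn hA
  have hopen : ∀ p, IsOpen (Set.range (PrimeSpectrum.comap (algebraMap C (D p)))) := fun p =>
    (PrimeSpectrum.isOpenMap_comap_of_hasGoingDown_of_finitePresentation
      (R := C) (S := D p)).isOpen_range
  -- Étale maps are open on spectra, so finitely many of the local splittings cover; their product
  -- is still étale and is surjective on spectra.
  obtain ⟨t, ht⟩ := isCompact_univ.elim_finite_subcover _ hopen
    fun p _ => Set.mem_iUnion.2 ⟨p, hp p⟩
  let E := ∀ p : t, D p
  refine ⟨E, inferInstance, inferInstance, inferInstance, ?_, ?_⟩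
  · refine Module.FaithfullyFlat.of_comap_surjective fun p => ?_
    obtain ⟨q, hq, r, hr⟩ := Set.mem_iUnion₂.1 (ht (Set.mem_univ p))
    refine ⟨PrimeSpectrum.comap (Pi.evalRingHom (fun p : t => D p) ⟨q, hq⟩) r, ?_⟩
    rw [← hr]
    rfl
  · exact nonempty_algEquiv_matrix_of_span_eq_top F hn (matrixPiHom fun p : t => φ p)
      (span_range_matrixPiHom _ fun p => hφ p)

-- A fibre over a residue field is a simple ring, hence nonzero, so rank zero is impossible at any
-- prime.
open Module in
theorem AzumayaFrame.subsingleton_of_rankAtStalk_eq_zero {C A : Type*} [CommRing C] [Ring A]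
    [Algebra C A] [Module.Finite C A] [Module.Projective C A] (F : AzumayaFrame C A)
    (hA : ∀ p : PrimeSpectrum C, rankAtStalk (R := C) A p = 0) : Subsingleton C := by
  by_contra h
  rw [not_subsingleton_iff_nontrivial] at h
  obtain ⟨p⟩ := (inferInstance : Nonempty (PrimeSpectrum C))
  let κ := p.asIdeal.ResidueField
  have := (F.baseChange κ).isSimpleRing
  have h₁ : finrank κ (κ ⊗[C] A) = 0 := finrank_tensor_of_rankAtStalk hA κ
  have : Subsingleton (κ ⊗[C] A) := Module.finrank_zero_iff.1 h₁
  exact not_subsingleton (κ ⊗[C] A) this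

end Splitting

end

theorem mainTheorem10 (C : Type u) [CommRing C] [Algebra ℂ C]
    (A : Type v) [Ring A] [Algebra C A] [IsAzumaya C A]
    (B : Type w) [Ring B] [Algebra C B] [IsAzumaya C B] :
    -- composition of roots
    (∃ (e : ∀ (R : Type x) [Ring R] [Algebra C R],
          RootAlgebra C A (RootAlgebra C B R) ≃ₐ[C] RootAlgebra C (A ⊗[C] B) R)
        (e' : ∀ (R : Type x) [Ring R] [Algebra C R],
          RootAlgebra C B (RootAlgebra C A R) ≃ₐ[C] RootAlgebra C (A ⊗[C] B) R),
        (∀ (R : Type x) [Ring R] [Algebra C R] (t : RootAlgebra C A (RootAlgebra C B R)),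
          (e R t : AlgCoprod C R (A ⊗[C] B)) =
            RootAlgebra.iterateMap R (Algebra.TensorProduct.includeLeft : A →ₐ[C] A ⊗[C] B)
              (Algebra.TensorProduct.includeRight : B →ₐ[C] A ⊗[C] B) t) ∧
        (∀ (R : Type x) [Ring R] [Algebra C R] (t : RootAlgebra C B (RootAlgebra C A R)),
          (e' R t : AlgCoprod C R (A ⊗[C] B)) =
            RootAlgebra.iterateMap R (Algebra.TensorProduct.includeRight : B →ₐ[C] A ⊗[C] B)
              (Algebra.TensorProduct.includeLeft : A →ₐ[C] A ⊗[C] B) t) ∧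
        (∀ (R : Type x) [Ring R] [Algebra C R] (R' : Type x) [Ring R'] [Algebra C R']
            (g : R →ₐ[C] R') (t : RootAlgebra C A (RootAlgebra C B R)),
          e R' (RootAlgebra.map A (RootAlgebra.map B g) t) =
            RootAlgebra.map (A ⊗[C] B) g (e R t)) ∧
        (∀ (R : Type x) [Ring R] [Algebra C R] (R' : Type x) [Ring R'] [Algebra C R']
            (g : R →ₐ[C] R') (t : RootAlgebra C B (RootAlgebra C A R)),
          e' R' (RootAlgebra.map B (RootAlgebra.map A g) t) =
            RootAlgebra.map (A ⊗[C] B) g (e' R t))) ∧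
    -- base change
    (∀ (D : Type y) [CommRing D] [Algebra C D],
      ∃ e : ∀ (R : Type x) [Ring R] [Algebra C R],
          D ⊗[C] RootAlgebra C A R ≃ₐ[D] RootAlgebra D (D ⊗[C] A) (D ⊗[C] R),
        (∀ (R : Type x) [Ring R] [Algebra C R] (d : D) (t : RootAlgebra C A R),
          (e R (d ⊗ₜ[C] t) : AlgCoprod D (D ⊗[C] R) (D ⊗[C] A)) =
            d • AlgCoprod.baseChange D (t : AlgCoprod C R A)) ∧
        (∀ (R : Type x) [Ring R] [Algebra C R] (R' : Type x) [Ring R'] [Algebra C R']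
            (g : R →ₐ[C] R') (t : D ⊗[C] RootAlgebra C A R),
          e R' (Algebra.TensorProduct.map (AlgHom.id D D) (RootAlgebra.map A g) t) =
            RootAlgebra.map (D ⊗[C] A) (Algebra.TensorProduct.map (AlgHom.id D D) g)
              (e R t))) ∧
    -- comparison with the root algebra of degree `n`, étale locally on `C`
    (∀ n : ℕ, (∀ p : PrimeSpectrum C, Module.rankAtStalk (R := C) A p = n ^ 2) →
      ∃ (D : Type u) (_ : CommRing D) (_ : Algebra C D),
        Algebra.Etale C D ∧ Module.FaithfullyFlat C D ∧
        ∀ (S : Type x) [Ring S] [Algebra ℂ S],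
          Nonempty (D ⊗[C] RootAlgebra C A (C ⊗[ℂ] S) ≃ₐ[D]
            D ⊗[C] (C ⊗[ℂ] NthRootAlgebra n S))) ∧
    -- functoriality in the Azumaya algebra
    (∀ f : A →ₐ[C] B,
      ∃ ψ : ∀ (R : Type x) [Ring R] [Algebra C R], RootAlgebra C B R →ₐ[C] RootAlgebra C A R,
        (∀ (R : Type x) [Ring R] [Algebra C R], RootAlgebra.IsInducedBy f (ψ R) ∧
          ∀ φ : RootAlgebra C B R →ₐ[C] RootAlgebra C A R,
            RootAlgebra.IsInducedBy f φ → φ = ψ R) ∧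
        (∀ (R : Type x) [Ring R] [Algebra C R] (R' : Type x) [Ring R'] [Algebra C R']
            (g : R →ₐ[C] R'),
          (ψ R').comp (RootAlgebra.map B g) = (RootAlgebra.map A g).comp (ψ R))) := by
  obtain ⟨F⟩ := IsAzumaya.nonempty_azumayaFrame C A
  obtain ⟨G⟩ := IsAzumaya.nonempty_azumayaFrame C B
  refine ⟨⟨fun R _ _ => RootAlgebra.iterateEquiv R G AlgEquiv.refl (fun _ => rfl) (fun _ => rfl),
      fun R _ _ => RootAlgebra.iterateEquiv R F (Algebra.TensorProduct.comm C A B)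
        (fun _ => rfl) (fun _ => rfl),
      fun _ _ _ _ => rfl, fun _ _ _ _ => rfl,
      fun _ _ _ _ _ _ g t => RootAlgebra.iterateEquiv_map _ _ _ _ g t,
      fun _ _ _ _ _ _ g t => RootAlgebra.iterateEquiv_map _ _ _ _ g t⟩, ?_, ?_, ?_⟩
  · intro D _ _
    exact ⟨fun R _ _ => RootAlgebra.baseChangeEquiv R D F,
      fun R _ _ d t => RootAlgebra.coe_baseChangeEquiv_tmul D F d t,
      fun _ _ _ _ _ _ g t => RootAlgebra.baseChangeEquiv_map D F g t⟩
  · intro n hA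
    -- Degree zero forces `C = 0`, where both sides vanish and `D = C` works.
    rcases eq_or_ne n 0 with rfl | hn
    · have := F.subsingleton_of_rankAtStalk_eq_zero (by simpa using hA)
      refine ⟨C, inferInstance, inferInstance, inferInstance, inferInstance, fun S _ _ => ?_⟩
      have h₁ := Module.subsingleton C (C ⊗[C] RootAlgebra C A (C ⊗[ℂ] S))
      have h₂ := Module.subsingleton C (C ⊗[C] (C ⊗[ℂ] NthRootAlgebra 0 S))
      exact ⟨AlgEquiv.ofLinearEquiv 0 (Subsingleton.elim _ _) (fun _ _ => Subsingleton.elim _ _)⟩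
    · let _ : Algebra ℚ C := Algebra.compHom C (algebraMap ℚ ℂ)
      obtain ⟨D, _, _, hD, hD', ⟨e⟩⟩ := exists_etale_algEquiv_matrix F hn hA
      refine ⟨D, inferInstance, inferInstance, hD, hD', fun S _ _ => ?_⟩
      let _ : Algebra ℂ D := Algebra.compHom D (algebraMap ℂ C)
      have : IsScalarTower ℂ C D := IsScalarTower.of_algebraMap_eq fun _ => rfl
      have : NeZero n := ⟨hn⟩
      have := IsAzumaya.matrix ℂ (Fin n)
      obtain ⟨H⟩ := IsAzumaya.nonempty_azumayaFrame ℂ (Matrix (Fin n) (Fin n) ℂ)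
      exact ⟨RootAlgebra.splitEquiv F H e S⟩
  · intro f
    exact ⟨fun R _ _ => RootAlgebra.induced R F G f,
      fun R _ _ => ⟨RootAlgebra.isInducedBy_induced F G f, fun φ h => h.eq_induced F G⟩,
      fun _ _ _ _ _ _ g => RootAlgebra.induced_comp_map F G f g⟩
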